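/- **Setting.** A state on a finite-dimensional complex Hilbert space $\mathcal H$ is a positive semidefinite operator of trace one; $\mathrm D(\mathcal H)$ is the set of states and $\mathrm P(\mathcal H)$ the set of pure states $|\psi\rangle\langle\psi|$, $\|\psi\|=1$. Let $\mathcal P\subseteq\mathcal S$ with $\mathcal S=\mathrm D(\mathcal H)$ or $\mathcal S=\mathrm P(\mathcal H)$. A state $\rho\in\mathcal S$ is $\varepsilon$-far from $\mathcal P$ if $\frac12\|\rho-\sigma\|_1\ge\varepsilon$ for all $\sigma\in\mathcal P$. An adaptive $k$-round, $\ell$-copy test uses $N=k\ell$ copies of an unknown $\rho\in\mathcal S$: in each of the $k$ rounds it performs a POVM with finitely many outcomes on $\ell$ fresh copies, where the POVM may depend on the outcomes of the earlier rounds, and at the end it accepts or rejects according to the outcomes obtained. It succeeds at distance $\varepsilon$ with one-sided error if it accepts every $\rho\in\mathcal P$ with probability $1$ and every $\rho\in\mathcal S$ that is $\varepsilon$-far from $\mathcal P$ with probability at most $2/3$. The copy complexity of testing $\mathcal P$ at distance $\varepsilon$ with one-sided error using adaptive $\ell$-copy measurements is the least $N=k\ell$ for which such a test exists ($\infty$ if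 there is none). Let $\mathsf{SR}(r)\subseteq\mathrm P(\mathbb C^{d_A}\otimes\mathbb C^{d_B})$ be the set of pure states of Schmidt rank at most $r$ and $\mathsf{Rank}(r)\subseteq\mathrm D(\mathbb C^d)$ the set of states of rank at most $r$. Let $N_{\mathsf{SR}}(d_A,d_B,r,\varepsilon)$ and $N_{\mathsf{Rank}}(d,r,\varepsilon)$ be the copy complexities of testing $\mathsf{SR}(r)$ (with $\mathcal S=\mathrm P(\mathbb C^{d_A}\otimes\mathbb C^{d_B})$) and $\mathsf{Rank}(r)$ (with $\mathcal S=\mathrm D(\mathbb C^d)$) at distance $\varepsilon$ with one-sided error using adaptive $(r+1)$-copy measurements. **Theorem.** There are universal constants $c,C>0$ such that for every integer $r\ge1$ the following hold. 1. For all $0<\varepsilon<\frac1{r+2}$ and all dimensions $d_A,d_B,d$, $$N_{\mathsf{SR}}(d_A,d_B,r,\varepsilon)\le C\,\frac{(r+1)!}{\varepsilon^{2r}},\qquad N_{\mathsf{Rank}}(d,r,\varepsilon)\le C\,\frac{(r+1)!}{\varepsilon^{r}}.$$ 2. There is a $D=D(r)$ such that for all $0<\varepsilon<\frac1{r+2}$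 and all $d_A,d_B,d\ge D$, $$N_{\mathsf{SR}}(d_A,d_B,r,\varepsilon)\ge c\,\frac{(r+1)!}{\varepsilon^{2r}},\qquad N_{\mathsf{Rank}}(d,r,\varepsilon)\ge c\,\frac{(r+1)!}{\varepsilon^{r}}.$$ That is, for $0<\varepsilon<\frac1{r+2}$ the dimension-independent copy complexities are $\Theta((r+1)!/\varepsilon^{2r})$ for $\mathsf{SR}(r)$ and $\Theta((r+1)!/\varepsilon^{r})$ for $\mathsf{Rank}(r)$. -/

import Mathlib

namespace StateTesting

open scoped ComplexOrder

/-- The tensor power `ρ^{⊗ ℓ}` of an operator on `ℂ^ι`, as an operator on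
`(ℂ^ι)^{⊗ ℓ} = ℂ^(Fin ℓ → ι)`. -/
def tensorPow {ι : Type} (ρ : Matrix ι ι ℂ) (ℓ : ℕ) :
    Matrix (Fin ℓ → ι) (Fin ℓ → ι) ℂ :=
  Matrix.of fun x y => ∏ i, ρ (x i) (y i)

/-- The set `D(ℂ^ι)` of quantum states (density operators). -/
def states (ι : Type) [Fintype ι] : Set (Matrix ι ι ℂ) :=
  {ρ | ρ.PosSemidef ∧ ρ.trace = 1}

/-- The operator `|ψ⟩⟨ψ|`. -/
def ketBra {ι : Type} (ψ : ι → ℂ) : Matrix ι ι ℂ :=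
  Matrix.vecMulVec ψ (star ψ)

/-- The set `P(ℂ^ι)` of pure states: the operators `|ψ⟩⟨ψ|` with `ψ` a unit vector. -/
def pureStates (ι : Type) [Fintype ι] : Set (Matrix ι ι ℂ) :=
  {ρ | ∃ ψ : ι → ℂ, star ψ ⬝ᵥ ψ = 1 ∧ ρ = ketBra ψ}

/-- The Schmidt rank of a vector of `ℂ^α ⊗ ℂ^β = ℂ^(α × β)`: the rank of its coefficient
matrix, that is, the number of nonzero coefficients in its Schmidt decomposition. -/
noncomputable def schmidtRank {α β : Type} [Fintype β] (ψ : α × β → ℂ) : ℕ :=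
  (Matrix.of fun (i : α) (j : β) => ψ (i, j)).rank

/-- The property `SR(r)` of bipartite pure states: having Schmidt rank at most `r`. -/
def schmidtRankAtMost (α β : Type) [Fintype α] [Fintype β] (r : ℕ) :
    Set (Matrix (α × β) (α × β) ℂ) :=
  {ρ | ∃ ψ : α × β → ℂ, star ψ ⬝ᵥ ψ = 1 ∧ schmidtRank ψ ≤ r ∧ ρ = ketBra ψ}

/-- The property `Rank(r)` of mixed states: having rank at most `r`. -/
def rankAtMost (ι : Type) [Fintype ι] (r : ℕ) : Set (Matrix ι ι ℂ) :=
  {ρ | ρ ∈ states ι ∧ ρ.rank ≤ r}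

/-- The trace norm `‖A‖₁ = Tr √(A† A)`: the sum of the singular values of `A`. -/
noncomputable def traceNorm {ι : Type} [Fintype ι] [DecidableEq ι] (A : Matrix ι ι ℂ) : ℝ :=
  ∑ i, Real.sqrt ((Matrix.isHermitian_conjTranspose_mul_self A).eigenvalues i)

/-- The trace distance `½ ‖ρ - σ‖₁`. -/
noncomputable def traceDist {ι : Type} [Fintype ι] [DecidableEq ι] (ρ σ : Matrix ι ι ℂ) : ℝ :=
  (1 / 2) * traceNorm (ρ - σ)

/-- `ρ` is `ε`-far from the property `P` in trace distance. -/
def IsFar {ι : Type} [Fintype ι] [DecidableEq ι]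
    (P : Set (Matrix ι ι ℂ)) (ε : ℝ) (ρ : Matrix ι ι ℂ) : Prop :=
  ∀ σ ∈ P, ε ≤ traceDist ρ σ

/-- A POVM on `ℂ^κ` with `m` outcomes. -/
structure POVM (κ : Type) [Fintype κ] [DecidableEq κ] (m : ℕ) where
  op : Fin m → Matrix κ κ ℂ
  posSemidef : ∀ x, (op x).PosSemidef
  sum_op : ∑ x, op x = 1

/-- Adaptive `k`-round, `ℓ`-copy tests for states on `ℂ^ι`. In each round a POVM is performed
on `ℓ` fresh copies of the unknown state; it may depend on the outcomes of all previous rounds.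
After the last round the test accepts (`true`) or rejects (`false`), depending on all
outcomes. -/
inductive AdaptiveTest (ι : Type) [Fintype ι] [DecidableEq ι] (ℓ : ℕ) : ℕ → Type
  | verdict (accept : Bool) : AdaptiveTest ι ℓ 0
  | round {k m : ℕ} (M : POVM (Fin ℓ → ι) m) (next : Fin m → AdaptiveTest ι ℓ k) :
      AdaptiveTest ι ℓ (k + 1)

/-- The probability that an adaptive test accepts, when every copy is in the state `ρ`: outcome
`x` of a round has probability `Tr (M_x ρ^{⊗ ℓ})`, and the test then goes on with `next x`. -/
noncomputable def AdaptiveTest.acceptProb {ι : Type} [Fintype ι] [DecidableEq ι] {ℓ : ℕ}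
    (ρ : Matrix ι ι ℂ) : {k : ℕ} → AdaptiveTest ι ℓ k → ℝ
  | _, .verdict accept => if accept then 1 else 0
  | _, .round M next => ∑ x, (M.op x * tensorPow ρ ℓ).trace.re * (next x).acceptProb ρ

/-- The test `T` for the property `P` of states in `S` has one-sided error (perfect completeness)
and is successful at distance `ε`: states in `P` are accepted with certainty, and the acceptance
probability of states in `S` that are `ε`-far from `P` is smaller by at least `1/3`. -/
def AdaptiveTest.SucceedsOneSided {ι : Type} [Fintype ι] [DecidableEq ι] {ℓ k : ℕ}
    (T : AdaptiveTest ι ℓ k) (S P : Set (Matrix ι ι ℂ)) (ε : ℝ) : Prop :=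
  (∀ ρ ∈ P, T.acceptProb ρ = 1) ∧ ∀ ρ ∈ S, IsFar P ε ρ → T.acceptProb ρ ≤ 1 - 1 / 3

/-- The copy complexity of testing the property `P` of states in `S` at distance `ε` with
one-sided error using adaptive `ℓ`-copy measurements: the least number `N = k ℓ` of copies
used by a successful adaptive test (`⊤` if there is none). -/
noncomputable def copyComplexity {ι : Type} [Fintype ι] [DecidableEq ι]
    (S P : Set (Matrix ι ι ℂ)) (ℓ : ℕ) (ε : ℝ) : ℕ∞ :=
  sInf {N : ℕ∞ | ∃ (k : ℕ) (T : AdaptiveTest ι ℓ k),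
    T.SucceedsOneSided S P ε ∧ N = ((k * ℓ : ℕ) : ℕ∞)}

/-- Copy complexity of testing `SR(r)` on `ℂ^dA ⊗ ℂ^dB` with one-sided error using adaptive
`(r+1)`-copy measurements. -/
noncomputable def schmidtRankCopyComplexity (dA dB r : ℕ) (ε : ℝ) : ℕ∞ :=
  copyComplexity (pureStates (Fin dA × Fin dB)) (schmidtRankAtMost (Fin dA) (Fin dB) r) (r + 1) ε

/-- Copy complexity of testing `Rank(r)` on `ℂ^d` with one-sided error using adaptive
`(r+1)`-copy measurements. -/
noncomputable def rankCopyComplexity (d r : ℕ) (ε : ℝ) : ℕ∞ :=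
  copyComplexity (states (Fin d)) (rankAtMost (Fin d) r) (r + 1) ε

end StateTesting

/-! Both problems are governed by one effect on `r + 1` copies: the antisymmetrizer `Π`, acting on
the copies of `ℂ^d` for `Rank(r)` and on the first tensor factors only for `SR(r)`. Its probability
is the elementary symmetric polynomial `e_{r+1}(λ)`, where `λ` is the spectrum of the state,
respectively of its reduced state (`trace_antisymmetrizer_mul`, `sum_det_submatrix_eq_injSum`). It
vanishes exactly on rank at most `r`. Choosing a trivial second factor, `ι ≃ ι × PUnit`, treats both
cases at once.

Upper bound. Measure `{Π, 1 - Π}` repeatedly and reject when `Π` occurs. Being `ε`-far forces mass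
at least `δ` outside any `r` eigenvalues, with `δ = ε` for mixed states and `δ = ε²` for bipartite
pure states (truncate the spectrum and renormalize). Then `e_{r+1}(λ) ≥ δ^r / (2 r!)` by
`le_injSum_of_tails`, so about `r! / δ^r` rounds of `r + 1` copies suffice.

Lower bound. The property is, up to scaling, the image of a vector space under `A ↦ A Aᴴ`,
respectively `(A, B) ↦ |A Bᵀ⟩⟨A Bᵀ|`, so probabilities are analytic along lines. Perfect
completeness makes every product (outcome probability) × (later rejection probability) vanish on the
whole family; analytic functions having no zero divisors, one factor vanishes identically. Hence
adaptivity does not help: by `AdaptiveTest.pow_le_acceptProb`, a state on which every effect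
vanishing on the family has probability at most `p` is accepted with probability at least `(1 -
p)^k`. Alternating multilinear algebra shows that no such effect has a larger probability than `Π`
(`trace_mul_le_of_vanishing_on_rank`, `trace_mul_le_of_vanishing_on_schmidtRank`). For a spectrum
with one large weight and many equal small ones, `Π` has probability at most `3 δ^r / r!`, although
the state is `ε`-far. -/

namespace StateTesting

open scoped ComplexOrder
open Matrix

/-! ### Trace norm, projections and the distance between pure states. -/

section LinearAlgebra

variable {ι : Type} [Fintype ι]

theorem star_dotProduct_ofReal_re (ψ : ι → ℂ) :
    star ψ ⬝ᵥ ψ = ((∑ i, ‖ψ i‖ ^ 2 : ℝ) : ℂ) := by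
  simp [dotProduct, Complex.conj_mul']

theorem norm_dotProduct_sq_le (ψ φ : ι → ℂ) :
    ‖star ψ ⬝ᵥ φ‖ ^ 2 ≤ (star ψ ⬝ᵥ ψ).re * (star φ ⬝ᵥ φ).re := by
  have h := norm_inner_le_norm (𝕜 := ℂ) (WithLp.toLp 2 ψ : EuclideanSpace ℂ ι) (WithLp.toLp 2 φ)
  rw [EuclideanSpace.inner_toLp_toLp, dotProduct_comm] at h
  rw [star_dotProduct_ofReal_re, star_dotProduct_ofReal_re, Complex.ofReal_re, Complex.ofReal_re]
  calc _ ≤ (‖(WithLp.toLp 2 ψ : EuclideanSpace ℂ ι)‖ *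
          ‖(WithLp.toLp 2 φ : EuclideanSpace ℂ ι)‖) ^ 2 := by
        gcongr
    _ = _ := by rw [mul_pow, EuclideanSpace.norm_sq_eq, EuclideanSpace.norm_sq_eq]

theorem ketBra_isHermitian (ψ : ι → ℂ) : (ketBra ψ).IsHermitian :=
  (posSemidef_vecMulVec_self_star ψ).isHermitian

theorem trace_ketBra (ψ : ι → ℂ) : (ketBra ψ).trace = star ψ ⬝ᵥ ψ := by
  rw [ketBra, trace_vecMulVec, dotProduct_comm]

theorem trace_ketBra_mul_ketBra (ψ φ : ι → ℂ) :
    (ketBra ψ * ketBra φ).trace = (‖star ψ ⬝ᵥ φ‖ ^ 2 : ℝ) := by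
  rw [ketBra, ketBra, vecMulVec_mul_vecMulVec, trace_vecMulVec, dotProduct_smul,
    dotProduct_comm ψ, smul_eq_mul]
  have : star φ ⬝ᵥ ψ = star (star ψ ⬝ᵥ φ) := star_dotProduct _ _
  rw [this, Complex.star_def, Complex.mul_conj']
  norm_cast

variable [DecidableEq ι]

theorem exists_unitary_diagonalization {A : Matrix ι ι ℂ} (hA : A.IsHermitian) :
    ∃ U : Matrix ι ι ℂ, Uᴴ * U = 1 ∧ U * Uᴴ = 1 ∧
      A = U * diagonal (fun i => (hA.eigenvalues i : ℂ)) * Uᴴ := by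
  refine ⟨hA.eigenvectorUnitary, ?_, ?_, ?_⟩
  · simpa [star_eq_conjTranspose] using Unitary.coe_star_mul_self hA.eigenvectorUnitary
  · simpa [star_eq_conjTranspose] using Unitary.coe_mul_star_self hA.eigenvectorUnitary
  · have := hA.spectral_theorem
    rw [Unitary.conjStarAlgAut_apply] at this
    simpa [star_eq_conjTranspose, Function.comp_def] using this

theorem isHermitian_conj_diagonal (U : Matrix ι ι ℂ) (μ : ι → ℝ) :
    (U * diagonal (fun i => (μ i : ℂ)) * Uᴴ).IsHermitian := by
  have : (diagonal (fun i => (μ i : ℂ))).IsHermitian := by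
    rw [isHermitian_diagonal_iff]
    intro i
    simp [isSelfAdjoint_iff]
  exact isHermitian_mul_mul_conjTranspose U this

theorem conj_diagonal_mul {U : Matrix ι ι ℂ} (hU : Uᴴ * U = 1) (μ ν : ι → ℂ) :
    (U * diagonal μ * Uᴴ) * (U * diagonal ν * Uᴴ) =
      U * diagonal (fun i => μ i * ν i) * Uᴴ := by
  calc _ = U * diagonal μ * (Uᴴ * U) * diagonal ν * Uᴴ := by simp only [Matrix.mul_assoc]
    _ = _ := by rw [hU, Matrix.mul_one, Matrix.mul_assoc U, diagonal_mul_diagonal]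

theorem trace_conj_diagonal {U : Matrix ι ι ℂ} (hU : Uᴴ * U = 1) (μ : ι → ℂ) :
    (U * diagonal μ * Uᴴ).trace = ∑ i, μ i := by
  rw [Matrix.mul_assoc, Matrix.trace_mul_comm, Matrix.mul_assoc, hU, Matrix.mul_one,
    trace_diagonal]

/-- Only the multiset of eigenvalues of `Aᴴ * A` matters, and it can be read off the characteristic
polynomial, which is invariant under the unitary conjugation. -/
theorem traceNorm_conj_diagonal {U : Matrix ι ι ℂ} (hU : Uᴴ * U = 1) (μ : ι → ℝ) :
    traceNorm (U * diagonal (fun i => (μ i : ℂ)) * Uᴴ) = ∑ i, |μ i| := by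
  set A := U * diagonal (fun i => (μ i : ℂ)) * Uᴴ with hAdef
  have hA : A.IsHermitian := isHermitian_conj_diagonal U μ
  have hsq : Aᴴ * A = U * diagonal (fun i => ((μ i ^ 2 : ℝ) : ℂ)) * Uᴴ := by
    rw [hA.eq, hAdef, conj_diagonal_mul hU]
    simp [sq]
  have hchar : (Aᴴ * A).charpoly =
      ∏ i, (Polynomial.X - Polynomial.C ((μ i ^ 2 : ℝ) : ℂ)) := by
    rw [hsq, charpoly_mul_comm, ← Matrix.mul_assoc, hU, Matrix.one_mul, charpoly_diagonal]
  have hroots := (isHermitian_conjTranspose_mul_self A).roots_charpoly_eq_eigenvalues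
  rw [hchar, Polynomial.roots_prod _ _
    (Finset.prod_ne_zero_iff.2 fun i _ => Polynomial.X_sub_C_ne_zero _)] at hroots
  simp only [Polynomial.roots_X_sub_C, Multiset.bind_singleton] at hroots
  have h := congrArg (fun s : Multiset ℂ => (s.map fun z => Real.sqrt z.re).sum) hroots
  simp only [Multiset.map_map, Function.comp_def] at h
  simp only [RCLike.ofReal_eq_complex_ofReal, Complex.ofReal_re, Real.sqrt_sq_eq_abs] at h
  exact h.symm

/-- In an eigenbasis of `A` the diagonal entries of `P` lie in `[0, 1]`, so the trace is at most the
sum of the positive eigenvalues. As the trace of `A` is zero, that sum is half the trace norm. -/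
theorem re_trace_mul_le_traceNorm {A P : Matrix ι ι ℂ} (hA : A.IsHermitian)
    (h0 : A.trace = 0) (hP : P.PosSemidef) (hP1 : (1 - P).PosSemidef) :
    (P * A).trace.re ≤ 1 / 2 * traceNorm A := by
  obtain ⟨U, hU, -, hAU⟩ := exists_unitary_diagonalization hA
  set μ := hA.eigenvalues
  have hnorm : traceNorm A = ∑ i, |μ i| := by
    conv_lhs => rw [hAU]
    exact traceNorm_conj_diagonal hU μ
  have hsum : ∑ i, μ i = 0 := by
    have := trace_conj_diagonal hU (fun i => (μ i : ℂ))
    rw [← hAU, h0] at this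
    exact_mod_cast this.symm
  have hR0 : ∀ i, 0 ≤ (Uᴴ * P * U) i i := fun i =>
    (hP.conjTranspose_mul_mul_same U).diag_nonneg
  have hR1 : ∀ i, 0 ≤ (1 - Uᴴ * P * U) i i := fun i => by
    have := (hP1.conjTranspose_mul_mul_same U).diag_nonneg (i := i)
    rwa [Matrix.mul_sub, Matrix.sub_mul, Matrix.mul_one, hU] at this
  have htr : (P * A).trace.re = ∑ i, ((Uᴴ * P * U) i i).re * μ i := by
    have : (P * A).trace = ∑ i, (Uᴴ * P * U) i i * (μ i : ℂ) := by
      conv_lhs => rw [hAU]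
      rw [← Matrix.mul_assoc, Matrix.trace_mul_comm, ← Matrix.mul_assoc, ← Matrix.mul_assoc]
      simp [Matrix.trace, Matrix.mul_diagonal]
    rw [this, Complex.re_sum]
    simp
  rw [htr, hnorm]
  have key : ∀ i, ((Uᴴ * P * U) i i).re * μ i ≤ 1 / 2 * |μ i| + 1 / 2 * μ i := by
    intro i
    have h1 := (Complex.le_def.1 (hR0 i)).1
    have h2 := (Complex.le_def.1 (hR1 i)).1
    simp at h1 h2
    rcases abs_cases (μ i) with ⟨h, h'⟩ | ⟨h, h'⟩ <;> rw [h] <;> nlinarith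
  calc _ ≤ ∑ i, (1 / 2 * |μ i| + 1 / 2 * μ i) := Finset.sum_le_sum fun i _ => key i
    _ = _ := by rw [Finset.sum_add_distrib, ← Finset.mul_sum, ← Finset.mul_sum, hsum]; ring

/-- The positive and the negative eigenvalues each have total absolute value `½ ‖A‖₁`, and a sum of
squares of nonnegative numbers is at most the square of their sum. -/
theorem two_mul_trace_sq_le_traceNorm_sq {A : Matrix ι ι ℂ} (hA : A.IsHermitian)
    (h0 : A.trace = 0) : 2 * (A * A).trace.re ≤ traceNorm A ^ 2 := by
  obtain ⟨U, hU, -, hAU⟩ := exists_unitary_diagonalization hA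
  set μ := hA.eigenvalues
  have hnorm : traceNorm A = ∑ i, |μ i| := by
    conv_lhs => rw [hAU]
    exact traceNorm_conj_diagonal hU μ
  have hsum : ∑ i, μ i = 0 := by
    have := trace_conj_diagonal hU (fun i => (μ i : ℂ))
    rw [← hAU, h0] at this
    exact_mod_cast this.symm
  have htr : (A * A).trace.re = ∑ i, μ i ^ 2 := by
    rw [show A * A = _ from congrArg₂ (· * ·) hAU hAU, conj_diagonal_mul hU,
      trace_conj_diagonal hU, Complex.re_sum]
    simp [sq]
  rw [hnorm, htr]
  have h1 : ∑ i, max (μ i) 0 = 1 / 2 * ∑ i, |μ i| := by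
    have : ∀ i, max (μ i) 0 = 1 / 2 * |μ i| + 1 / 2 * μ i := fun i => by
      rcases abs_cases (μ i) with ⟨h, h'⟩ | ⟨h, h'⟩ <;> rw [h]
      · rw [max_eq_left h']; ring
      · rw [max_eq_right h'.le]; ring
    simp_rw [this, Finset.sum_add_distrib, ← Finset.mul_sum, hsum]; ring
  have h2 : ∑ i, max (-μ i) 0 = 1 / 2 * ∑ i, |μ i| := by
    have : ∀ i, max (-μ i) 0 = 1 / 2 * |μ i| - 1 / 2 * μ i := fun i => by
      rcases abs_cases (μ i) with ⟨h, h'⟩ | ⟨h, h'⟩ <;> rw [h]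
      · rw [max_eq_right (by linarith)]; ring
      · rw [max_eq_left (by linarith)]; ring
    simp_rw [this, Finset.sum_sub_distrib, ← Finset.mul_sum, hsum]; ring
  have h3 : ∑ i, μ i ^ 2 = ∑ i, max (μ i) 0 ^ 2 + ∑ i, max (-μ i) 0 ^ 2 := by
    rw [← Finset.sum_add_distrib]
    refine Finset.sum_congr rfl fun i _ => ?_
    rcases le_total 0 (μ i) with h | h
    · rw [max_eq_left h, max_eq_right (by linarith)]; ring
    · rw [max_eq_right h, max_eq_left (by linarith)]; ring
  have h4 : ∑ i, max (μ i) 0 ^ 2 ≤ (∑ i, max (μ i) 0) ^ 2 :=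
    Finset.sum_sq_le_sq_sum_of_nonneg fun i _ => le_max_right _ _
  have h5 : ∑ i, max (-μ i) 0 ^ 2 ≤ (∑ i, max (-μ i) 0) ^ 2 :=
    Finset.sum_sq_le_sq_sum_of_nonneg fun i _ => le_max_right _ _
  rw [h1] at h4
  rw [h2] at h5
  nlinarith

theorem traceNorm_sq_le_rank_mul {A : Matrix ι ι ℂ} (hA : A.IsHermitian) :
    traceNorm A ^ 2 ≤ A.rank * (A * A).trace.re := by
  obtain ⟨U, hU, -, hAU⟩ := exists_unitary_diagonalization hA
  have hrank := hA.rank_eq_card_non_zero_eigs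
  set μ := hA.eigenvalues
  have hnorm : traceNorm A = ∑ i, |μ i| := by
    conv_lhs => rw [hAU]
    exact traceNorm_conj_diagonal hU μ
  have htr : (A * A).trace.re = ∑ i, μ i ^ 2 := by
    rw [show A * A = _ from congrArg₂ (· * ·) hAU hAU, conj_diagonal_mul hU,
      trace_conj_diagonal hU, Complex.re_sum]
    simp [sq]
  rw [hnorm, htr, hrank, Fintype.card_subtype]
  have h1 : ∑ i, |μ i| = ∑ i with μ i ≠ 0, |μ i| := by
    rw [Finset.sum_filter]
    exact Finset.sum_congr rfl fun i _ => by by_cases h : μ i = 0 <;> simp [h]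
  have h2 : ∑ i, μ i ^ 2 = ∑ i with μ i ≠ 0, |μ i| ^ 2 := by
    rw [Finset.sum_filter]
    exact Finset.sum_congr rfl fun i _ => by by_cases h : μ i = 0 <;> simp [h]
  rw [h1, h2]
  exact sq_sum_le_card_mul_sum_sq

/-- The orthogonal projection onto the range of a Hermitian matrix. -/
theorem exists_support_projection {B : Matrix ι ι ℂ} (hB : B.IsHermitian) :
    ∃ Q : Matrix ι ι ℂ, Q.IsHermitian ∧ Q * Q = Q ∧ Q * B = B ∧ Q.trace = B.rank := by
  obtain ⟨U, hU, -, hBU⟩ := exists_unitary_diagonalization hB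
  have hrank := hB.rank_eq_card_non_zero_eigs
  set μ := hB.eigenvalues
  refine ⟨U * diagonal (fun i => ((if μ i = 0 then 0 else 1 : ℝ) : ℂ)) * Uᴴ,
    isHermitian_conj_diagonal U _, ?_, ?_, ?_⟩
  · rw [conj_diagonal_mul hU]
    congr 3
    ext i
    by_cases h : μ i = 0 <;> simp [h]
  · conv_lhs => rw [hBU]
    conv_rhs => rw [hBU]
    rw [conj_diagonal_mul hU]
    congr 3
    ext i
    by_cases h : μ i = 0 <;> simp [h]
  · rw [trace_conj_diagonal hU, hrank, Fintype.card_subtype]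
    rw [Finset.card_filter]
    push_cast
    exact Finset.sum_congr rfl fun i _ => by by_cases h : μ i = 0 <;> simp [h]

theorem posSemidef_of_projection {κ : Type} [Fintype κ] {Q : Matrix κ κ ℂ}
    (hQ : Q.IsHermitian) (hQ2 : Q * Q = Q) : Q.PosSemidef := by
  have := posSemidef_conjTranspose_mul_self Q
  rwa [hQ.eq, hQ2] at this

theorem posSemidef_one_sub_of_projection {κ : Type} [Fintype κ] [DecidableEq κ]
    {Q : Matrix κ κ ℂ} (hQ : Q.IsHermitian) (hQ2 : Q * Q = Q) : (1 - Q).PosSemidef := by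
  refine posSemidef_of_projection (isHermitian_one.sub hQ) ?_
  rw [Matrix.mul_sub, Matrix.sub_mul, Matrix.sub_mul, Matrix.mul_one, Matrix.mul_one,
    Matrix.one_mul, hQ2, sub_self, sub_zero]

/-- A Ky Fan type bound: the diagonal entries of `Q` lie in `[0, 1]` and sum to at most `r`, so the
best choice is full weight on `i₀` and the remaining `r - 1` units on values at most `a`. -/
theorem trace_projection_mul_diagonal_le {Q : Matrix ι ι ℂ} (hQ : Q.IsHermitian)
    (hQ2 : Q * Q = Q) {r : ℕ} (hr : Q.trace.re ≤ r) {lam : ι → ℝ} {i₀ : ι} {a b : ℝ}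
    (ha : 0 ≤ a) (hab : a ≤ b) (h0 : lam i₀ ≤ b) (h : ∀ i, i ≠ i₀ → lam i ≤ a) :
    (Q * diagonal (fun i => (lam i : ℂ))).trace.re ≤ b + (r - 1) * a := by
  have hpos : ∀ i, 0 ≤ (Q i i).re := fun i =>
    (Complex.le_def.1 (posSemidef_of_projection hQ hQ2).diag_nonneg).1
  have hle : ∀ i, (Q i i).re ≤ 1 := fun i => by
    have := (Complex.le_def.1
      ((posSemidef_one_sub_of_projection hQ hQ2).diag_nonneg (i := i))).1
    simpa using this
  have htr : (Q * diagonal (fun i => (lam i : ℂ))).trace.re = ∑ i, (Q i i).re * lam i := by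
    simp [Matrix.trace, Matrix.mul_diagonal]
  have hQtr : Q.trace.re = ∑ i, (Q i i).re := by simp [Matrix.trace]
  rw [htr]
  calc ∑ i, (Q i i).re * lam i
      ≤ ∑ i, ((Q i i).re * a + if i = i₀ then b - a else 0) := by
        refine Finset.sum_le_sum fun i _ => ?_
        split_ifs with hi
        · subst hi
          nlinarith [hpos i, hle i]
        · nlinarith [hpos i, hle i, h i hi]
    _ = Q.trace.re * a + (b - a) := by
        rw [Finset.sum_add_distrib, ← Finset.sum_mul, hQtr]; simp
    _ ≤ _ := by nlinarith

/-- The difference is traceless of rank at most two, so the bounds `2 Tr A² ≤ ‖A‖₁² ≤ rank A · Tr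
A²` coincide. -/
theorem traceDist_ketBra_sq {ψ φ : ι → ℂ} (hψ : star ψ ⬝ᵥ ψ = 1) (hφ : star φ ⬝ᵥ φ = 1) :
    traceDist (ketBra ψ) (ketBra φ) ^ 2 = 1 - ‖star ψ ⬝ᵥ φ‖ ^ 2 := by
  set A := ketBra ψ - ketBra φ with hAdef
  have hA : A.IsHermitian := (ketBra_isHermitian ψ).sub (ketBra_isHermitian φ)
  have h0 : A.trace = 0 := by
    rw [hAdef, trace_sub, trace_ketBra, trace_ketBra, hψ, hφ, sub_self]
  have hAA : (A * A).trace.re = 2 * (1 - ‖star ψ ⬝ᵥ φ‖ ^ 2) := by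
    rw [hAdef, sub_mul, mul_sub, mul_sub]
    simp only [trace_sub, trace_mul_comm (ketBra φ) (ketBra ψ), trace_ketBra_mul_ketBra, hψ, hφ]
    simp
    norm_cast
    ring
  have hrank : A.rank ≤ 2 := by
    have : A = (of fun i (k : Bool) => cond k (ψ i) (-φ i)) *
        (of fun (k : Bool) j => cond k (star ψ j) (star φ j)) := by
      ext i j
      simp [hAdef, ketBra, vecMulVec_apply, Matrix.mul_apply, sub_eq_add_neg]
    rw [this]
    exact (rank_mul_le_left _ _).trans ((rank_le_card_width _).trans (by simp))
  have hpos : 0 ≤ (A * A).trace.re := by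
    have := (posSemidef_conjTranspose_mul_self A).trace_nonneg
    rw [hA.eq] at this
    exact (Complex.le_def.1 this).1
  have h1 := two_mul_trace_sq_le_traceNorm_sq hA h0
  have h2 := traceNorm_sq_le_rank_mul hA
  have h3 : (A.rank : ℝ) ≤ 2 := by exact_mod_cast hrank
  rw [traceDist, ← hAdef]
  nlinarith

end LinearAlgebra

/-! ### Elementary symmetric polynomials as sums over injective tuples. -/

section InjectiveSums

variable {ι : Type} [Fintype ι] [DecidableEq ι]

/-- The sum of the products `∏ i, f (k i)` over all injective `k : Fin n → ι` avoiding `S`. It is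
`n !` times an elementary symmetric polynomial. -/
noncomputable def injSum {R : Type} [CommSemiring R] (f : ι → R) (n : ℕ) (S : Finset ι) : R :=
  ∑ k : Fin n → ι, if Function.Injective k ∧ ∀ i, k i ∉ S then ∏ i, f (k i) else 0

theorem injSum_zero {R : Type} [CommSemiring R] (f : ι → R) (S : Finset ι) :
    injSum f 0 S = 1 := by
  simp [injSum, Function.injective_of_subsingleton]

theorem injSum_succ {R : Type} [CommSemiring R] (f : ι → R) (n : ℕ) (S : Finset ι) :
    injSum f (n + 1) S = ∑ x ∈ Sᶜ, f x * injSum f n (insert x S) := by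
  rw [injSum, ← (Fin.consEquiv fun _ : Fin (n + 1) => ι).sum_comp, Fintype.sum_prod_type,
    ← Finset.sum_subset (Finset.subset_univ Sᶜ)]
  · refine Finset.sum_congr rfl fun x hx => ?_
    rw [injSum, Finset.mul_sum]
    refine Finset.sum_congr rfl fun k _ => ?_
    rw [mul_ite, mul_zero]
    have hcons : (Fin.consEquiv fun _ : Fin (n + 1) => ι) (x, k) = Fin.cons x k := rfl
    simp only [hcons, Fin.prod_univ_succ, Fin.cons_zero, Fin.cons_succ]
    refine if_congr ?_ rfl rfl
    rw [Finset.mem_compl] at hx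
    rw [Fin.cons_injective_iff, Fin.forall_fin_succ]
    simp only [Fin.cons_zero, Fin.cons_succ, Set.mem_range, not_exists, Finset.mem_insert, not_or]
    constructor
    · rintro ⟨⟨h1, h2⟩, h3, h4⟩
      exact ⟨h2, fun i => ⟨h1 i, h4 i⟩⟩
    · rintro ⟨h1, h2⟩
      exact ⟨⟨fun i => (h2 i).1, h1⟩, hx, fun i => (h2 i).2⟩
  · intro x _ hx
    refine Finset.sum_eq_zero fun k _ => if_neg ?_
    rintro ⟨-, h⟩
    exact hx (Finset.mem_compl.2 (by simpa using h 0))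

variable {lam : ι → ℝ}

/-- Choose the entries one at a time: at most `r` indices are excluded at each choice, so mass at
least `δ` is always left. -/
theorem pow_le_injSum (h0 : ∀ i, 0 ≤ lam i) {δ : ℝ} (hδ : 0 ≤ δ) {r : ℕ}
    (h : ∀ S : Finset ι, S.card ≤ r → δ ≤ ∑ i ∈ Sᶜ, lam i) (n : ℕ) (S : Finset ι)
    (hS : S.card + n ≤ r + 1) : δ ^ n ≤ injSum lam n S := by
  induction n generalizing S with
  | zero => simp [injSum_zero]
  | succ n ih =>
    rw [injSum_succ, pow_succ']
    calc δ * δ ^ n ≤ (∑ x ∈ Sᶜ, lam x) * δ ^ n := by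
          gcongr
          exact h S (by omega)
      _ ≤ _ := by
          rw [Finset.sum_mul]
          refine Finset.sum_le_sum fun x hx => mul_le_mul_of_nonneg_left (ih _ ?_) (h0 x)
          have := Finset.card_insert_le x S
          omega

/-- The left side counts the tuples that use `x`, which may stand in any of `n + 1` positions. -/
theorem mul_injSum_insert_le (h0 : ∀ i, 0 ≤ lam i) (n : ℕ) (S : Finset ι) {x : ι} (hx : x ∉ S) :
    (n + 1) * lam x * injSum lam n (insert x S) ≤ injSum lam (n + 1) S := by
  induction n generalizing S with
  | zero =>
    rw [injSum_succ]
    simp only [injSum_zero]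
    have := Finset.single_le_sum (f := lam) (fun i _ => h0 i) (Finset.mem_compl.2 hx)
    simpa using this
  | succ n ih =>
    rw [injSum_succ lam (n + 1), ← Finset.add_sum_erase _ _ (Finset.mem_compl.2 hx)]
    have hset : Sᶜ.erase x = (insert x S)ᶜ := by
      ext; simp
    have h1 : (n + 1) * lam x * injSum lam (n + 1) (insert x S) ≤
        ∑ y ∈ Sᶜ.erase x, lam y * injSum lam (n + 1) (insert y S) := by
      rw [injSum_succ, hset, Finset.mul_sum]
      refine Finset.sum_le_sum fun y hy => ?_
      have hy' : x ∉ insert y S := by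
        simp only [Finset.mem_compl, Finset.mem_insert, not_or] at hy ⊢
        exact ⟨fun h => hy.1 h.symm, hx⟩
      have := mul_le_mul_of_nonneg_left (ih _ hy') (h0 y)
      rw [Finset.insert_comm]
      linarith
    push_cast
    linarith

/-- If some weight is at least `1/2`, placing it in one of the `r + 1` positions gives the factor
`(r + 1) / 2`. Otherwise the first two choices have mass `1` and at least `1/2`; this saves a factor
`δ`, and `δ (r + 2) ≤ 1` converts the saving into `r + 1`. -/
theorem le_injSum_of_tails (h0 : ∀ i, 0 ≤ lam i) (h1 : ∑ i, lam i = 1) {δ : ℝ} (hδ : 0 ≤ δ)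
    {r : ℕ} (hr : 1 ≤ r) (hδr : δ * (r + 2) ≤ 1)
    (h : ∀ S : Finset ι, S.card ≤ r → δ ≤ ∑ i ∈ Sᶜ, lam i) :
    (r + 1) / 2 * δ ^ r ≤ injSum lam (r + 1) ∅ := by
  by_cases hx : ∃ x, 1 / 2 ≤ lam x
  · obtain ⟨x, hx⟩ := hx
    have h2 := mul_injSum_insert_le h0 r ∅ (Finset.notMem_empty x)
    have h3 := pow_le_injSum h0 hδ h r {x} (by simp; omega)
    refine le_trans ?_ h2
    simp only [insert_empty_eq]
    have h4 : 0 ≤ δ ^ r := by positivity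
    have h5 : 0 ≤ (r : ℝ) + 1 := by positivity
    calc (r + 1) / 2 * δ ^ r = (r + 1) * (1 / 2) * δ ^ r := by ring
      _ ≤ (r + 1) * lam x * injSum lam r {x} := by gcongr
  · push Not at hx
    obtain ⟨s, rfl⟩ : ∃ s, r = s + 1 := ⟨r - 1, by omega⟩
    have h4 : 0 ≤ δ ^ s := by positivity
    have h2 : ∀ x, 1 / 2 * δ ^ s ≤ injSum lam (s + 1) {x} := by
      intro x
      have hc : ∑ y ∈ ({x} : Finset ι)ᶜ, lam y = 1 - lam x := by
        rw [← h1, ← Finset.sum_compl_add_sum {x}]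
        simp
      calc 1 / 2 * δ ^ s ≤ (∑ y ∈ ({x} : Finset ι)ᶜ, lam y) * δ ^ s := by
            gcongr
            rw [hc]
            linarith [hx x]
        _ ≤ _ := by
          rw [injSum_succ, Finset.sum_mul]
          refine Finset.sum_le_sum fun y _ => mul_le_mul_of_nonneg_left ?_ (h0 y)
          refine pow_le_injSum h0 hδ h s _ ?_
          have := Finset.card_le_two (a := y) (b := x)
          omega
    have h3 : 1 / 2 * δ ^ s ≤ injSum lam (s + 1 + 1) ∅ := by
      calc 1 / 2 * δ ^ s = ∑ x, lam x * (1 / 2 * δ ^ s) := by rw [← Finset.sum_mul, h1, one_mul]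
        _ ≤ _ := by
          rw [injSum_succ]
          simp only [Finset.compl_empty, insert_empty_eq]
          exact Finset.sum_le_sum fun x _ => mul_le_mul_of_nonneg_left (h2 x) (h0 x)
    refine le_trans ?_ h3
    push_cast at hδr ⊢
    rw [pow_succ]
    nlinarith [mul_nonneg h4 hδ]

theorem injSum_le (h0 : ∀ i, 0 ≤ lam i) (x₀ : ι) (r : ℕ) :
    injSum lam (r + 1) ∅ ≤ (r + 1) * (∑ i, lam i) * (∑ i ∈ {x₀}ᶜ, lam i) ^ r := by
  -- The weights `w i` leave position `i` free and forbid `x₀` elsewhere. An injective tuple meets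
  -- `x₀` at most once, so it is counted for at least one `i`.
  let w : Fin (r + 1) → Fin (r + 1) → ι → ℝ := fun i j x =>
    if j = i then lam x else if x = x₀ then 0 else lam x
  have hw : ∀ i j x, 0 ≤ w i j x := fun i j x => by
    simp only [w]
    split_ifs
    exacts [h0 x, le_rfl, h0 x]
  have hsum : ∀ i, ∑ k : Fin (r + 1) → ι, ∏ j, w i j (k j) =
      (∑ i, lam i) * (∑ i ∈ {x₀}ᶜ, lam i) ^ r := by
    intro i
    have hc : ∑ x ∈ ({x₀} : Finset ι)ᶜ, lam x = ∑ x, if x = x₀ then 0 else lam x := by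
      rw [← Finset.sum_subset (Finset.subset_univ ({x₀} : Finset ι)ᶜ)]
      · exact Finset.sum_congr rfl fun x hx => by rw [if_neg (by simpa using hx)]
      · intro x _ hx
        rw [if_pos (by simpa using hx)]
    rw [← Fintype.prod_sum, ← Finset.mul_prod_erase _ _ (Finset.mem_univ i), hc]
    congr 1
    · simp [w]
    · rw [Finset.prod_congr rfl (g := fun _ => ∑ x, if x = x₀ then 0 else lam x), Finset.prod_const]
      · simp
      · intro j hj
        simp [w, Finset.ne_of_mem_erase hj]
  calc injSum lam (r + 1) ∅
      ≤ ∑ k : Fin (r + 1) → ι, ∑ i, ∏ j, w i j (k j) := by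
        refine Finset.sum_le_sum fun k _ => ?_
        have hnn : ∀ i, 0 ≤ ∏ j, w i j (k j) := fun i => Finset.prod_nonneg fun j _ => hw i j _
        split_ifs with hk
        · obtain ⟨i, hi⟩ : ∃ i, ∀ j, j ≠ i → k j ≠ x₀ := by
            by_cases hex : ∃ i, k i = x₀
            · obtain ⟨i, hi⟩ := hex
              exact ⟨i, fun j hj h => hj (hk.1 (h.trans hi.symm))⟩
            · exact ⟨0, fun j _ h => hex ⟨j, h⟩⟩
          have : ∏ j, lam (k j) = ∏ j, w i j (k j) := by
            refine Finset.prod_congr rfl fun j _ => ?_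
            by_cases hj : j = i
            · simp [w, hj]
            · simp [w, hj, hi j hj]
          rw [this]
          exact Finset.single_le_sum (fun i _ => hnn i) (Finset.mem_univ i)
        · exact Finset.sum_nonneg fun i _ => hnn i
    _ = _ := by
      rw [Finset.sum_comm, Finset.sum_congr rfl fun i _ => hsum i]
      simp [mul_assoc]

theorem injSum_eq_zero_of_card_lt {R : Type} [CommSemiring R] {f : ι → R} {n : ℕ}
    {T : Finset ι} (hT : T.card < n) (hf : ∀ i ∉ T, f i = 0) (S : Finset ι) :
    injSum f n S = 0 := by
  refine Finset.sum_eq_zero fun k _ => ?_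
  split_ifs with hk
  · obtain ⟨i, hi⟩ : ∃ i, k i ∉ T := by
      by_contra! hcon
      have := Finset.card_le_card_of_injOn (s := Finset.univ) k (fun i _ => hcon i) hk.1.injOn
      simp at this
      omega
    exact Finset.prod_eq_zero (Finset.mem_univ i) (hf _ hi)
  · rfl

/-- Expand by the Leibniz formula and sum over `a` first: orthonormality of the columns of `U`
leaves, for each tuple `k` of eigenvalue indices, the determinant of the identity restricted to `k`.
This is `1` if `k` is injective and has two equal rows otherwise. -/
theorem sum_det_submatrix_conj_diagonal {U : Matrix ι ι ℂ} (hU : Uᴴ * U = 1) (μ : ι → ℂ)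
    (n : ℕ) :
    ∑ a : Fin n → ι, ((U * diagonal μ * Uᴴ).submatrix a a).det = injSum μ n ∅ := by
  have hentry : ∀ x y, (U * diagonal μ * Uᴴ) x y = ∑ k, U x k * μ k * star (U y k) := by
    intro x y
    rw [Matrix.mul_apply]
    exact Finset.sum_congr rfl fun k _ => by rw [Matrix.mul_diagonal, conjTranspose_apply]
  have horth : ∀ k l, ∑ x, U x k * star (U x l) = (1 : Matrix ι ι ℂ) k l := by
    intro k l
    have := congrFun (congrFun hU l) k
    rw [Matrix.mul_apply] at this
    rw [one_apply, ← if_congr (eq_comm (a := l) (b := k)) rfl rfl, ← one_apply, ← this]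
    exact Finset.sum_congr rfl fun x _ => by rw [conjTranspose_apply, mul_comm]
  have hperm : ∀ σ : Equiv.Perm (Fin n),
      ∑ a : Fin n → ι, ∏ i, (U * diagonal μ * Uᴴ) (a (σ i)) (a i) =
        ∑ k : Fin n → ι, (∏ i, μ (k i)) * ∏ i, (1 : Matrix ι ι ℂ) (k (σ.symm i)) (k i) := by
    intro σ
    simp only [hentry, Fintype.prod_sum]
    rw [Finset.sum_comm]
    refine Finset.sum_congr rfl fun k _ => ?_
    simp only [← horth, Fintype.prod_sum, Finset.mul_sum]
    refine Finset.sum_congr rfl fun a _ => ?_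
    simp only [Finset.prod_mul_distrib]
    rw [← Equiv.prod_comp σ fun i => U (a i) (k (σ.symm i))]
    simp only [Equiv.symm_apply_apply]
    ring
  simp only [det_apply, submatrix_apply]
  rw [Finset.sum_comm]
  simp only [← Finset.smul_sum, hperm]
  simp only [Finset.smul_sum]
  rw [Finset.sum_comm, injSum]
  refine Finset.sum_congr rfl fun k _ => ?_
  have hdet : ∑ σ : Equiv.Perm (Fin n),
      Equiv.Perm.sign σ • ((∏ i, μ (k i)) * ∏ i, (1 : Matrix ι ι ℂ) (k (σ.symm i)) (k i)) =
      (∏ i, μ (k i)) * ((1 : Matrix ι ι ℂ).submatrix k k).det := by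
    rw [det_apply, Finset.mul_sum, ← Equiv.sum_comp (Equiv.inv (Equiv.Perm (Fin n)))]
    refine Finset.sum_congr rfl fun σ _ => ?_
    rw [Equiv.inv_apply, Equiv.Perm.sign_inv, mul_smul_comm]
    rfl
  rw [hdet]
  by_cases hk : Function.Injective k
  · simp [hk, submatrix_one k hk]
  · obtain ⟨i, j, hij, hne⟩ : ∃ i j, k i = k j ∧ i ≠ j := by
      simpa [Function.Injective] using hk
    rw [det_zero_of_row_eq hne (by ext l; rw [submatrix_apply, submatrix_apply, hij])]
    simp [hk]

theorem sum_det_submatrix_eq_injSum {A : Matrix ι ι ℂ} (hA : A.IsHermitian) (n : ℕ) :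
    ∑ a : Fin n → ι, (A.submatrix a a).det = (injSum hA.eigenvalues n ∅ : ℝ) := by
  obtain ⟨U, hU, -, hAU⟩ := exists_unitary_diagonalization hA
  conv_lhs => rw [hAU]
  rw [sum_det_submatrix_conj_diagonal hU, injSum, injSum, Complex.ofReal_sum]
  refine Finset.sum_congr rfl fun k _ => ?_
  split_ifs <;> simp

theorem sum_det_submatrix_eq_zero {A : Matrix ι ι ℂ} (hA : A.IsHermitian) {n : ℕ}
    (hn : A.rank < n) : ∑ a : Fin n → ι, (A.submatrix a a).det = 0 := by
  rw [sum_det_submatrix_eq_injSum hA, injSum_eq_zero_of_card_lt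
    (T := {i | hA.eigenvalues i ≠ 0}) (by
      rwa [← Fintype.card_subtype, ← hA.rank_eq_card_non_zero_eigs]) (by simp)]
  simp

end InjectiveSums

/-! ### Tensor powers: positivity, trace and analyticity. -/

section TensorPower

variable {ι : Type} {ℓ : ℕ}

theorem tensorPow_smul (c : ℂ) (ρ : Matrix ι ι ℂ) :
    tensorPow (c • ρ) ℓ = c ^ ℓ • tensorPow ρ ℓ := by
  ext x y
  simp [tensorPow, Finset.prod_mul_distrib]

theorem tensorPow_ketBra (ψ : ι → ℂ) :
    tensorPow (ketBra ψ) ℓ = ketBra fun x : Fin ℓ → ι => ∏ i, ψ (x i) := by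
  ext x y
  simp [tensorPow, ketBra, vecMulVec_apply, Finset.prod_mul_distrib]

variable [Fintype ι]

theorem tensorPow_conjTranspose_mul_self (B : Matrix ι ι ℂ) :
    tensorPow (Bᴴ * B) ℓ = (tensorPow B ℓ)ᴴ * tensorPow B ℓ := by
  classical
  ext x y
  simp [tensorPow, Matrix.mul_apply, Fintype.prod_sum, Finset.prod_mul_distrib]

theorem trace_tensorPow (ρ : Matrix ι ι ℂ) : (tensorPow ρ ℓ).trace = ρ.trace ^ ℓ := by
  classical
  have := (Fintype.prod_sum fun (_ : Fin ℓ) (j : ι) => ρ j j).symm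
  simpa [tensorPow, Matrix.trace] using this

theorem exists_eq_conjTranspose_mul_self {κ : Type} [Fintype κ] {A : Matrix κ κ ℂ}
    (hA : A.PosSemidef) : ∃ B : Matrix κ κ ℂ, A = Bᴴ * B := by
  classical
  obtain ⟨U, hU, -, hAU⟩ := exists_unitary_diagonalization hA.isHermitian
  refine ⟨diagonal (fun i => ((√(hA.isHermitian.eigenvalues i) : ℝ) : ℂ)) * Uᴴ, ?_⟩
  rw [conjTranspose_mul, conjTranspose_conjTranspose, diagonal_conjTranspose,
    Matrix.mul_assoc, ← Matrix.mul_assoc (diagonal _) (diagonal _), diagonal_mul_diagonal,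
    ← Matrix.mul_assoc]
  conv_lhs => rw [hAU]
  congr 3
  ext i
  have := Real.mul_self_sqrt (hA.eigenvalues_nonneg i)
  simp only [Pi.star_apply, Complex.star_def, Complex.conj_ofReal, ← Complex.ofReal_mul, this]

theorem posSemidef_tensorPow {ρ : Matrix ι ι ℂ} (hρ : ρ.PosSemidef) :
    (tensorPow ρ ℓ).PosSemidef := by
  obtain ⟨B, rfl⟩ := exists_eq_conjTranspose_mul_self hρ
  rw [tensorPow_conjTranspose_mul_self]
  exact posSemidef_conjTranspose_mul_self _

theorem trace_mul_nonneg {κ : Type} [Fintype κ] {A B : Matrix κ κ ℂ} (hA : A.PosSemidef)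
    (hB : B.PosSemidef) : 0 ≤ (A * B).trace.re := by
  obtain ⟨C, rfl⟩ := exists_eq_conjTranspose_mul_self hB
  rw [← Matrix.mul_assoc, trace_mul_comm, ← Matrix.mul_assoc]
  exact (Complex.le_def.1 (hA.mul_mul_conjTranspose_same C).trace_nonneg).1

theorem analyticOnNhd_trace {ρ : ℝ → Matrix ι ι ℂ}
    (h : ∀ i j, AnalyticOnNhd ℝ (fun t => ρ t i j) Set.univ)
    (M : Matrix (Fin ℓ → ι) (Fin ℓ → ι) ℂ) :
    AnalyticOnNhd ℝ (fun t => (M * tensorPow (ρ t) ℓ).trace.re) Set.univ := by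
  have h1 : AnalyticOnNhd ℝ (fun t => (M * tensorPow (ρ t) ℓ).trace) Set.univ := by
    simp only [Matrix.trace, diag_apply, Matrix.mul_apply, tensorPow, of_apply]
    exact Finset.analyticOnNhd_fun_sum _ fun x _ => Finset.analyticOnNhd_fun_sum _ fun y _ =>
      analyticOnNhd_const.mul (Finset.analyticOnNhd_fun_prod _ fun i _ => h _ _)
  exact fun t ht => (Complex.reCLM.analyticAt _).comp (h1 t ht)

end TensorPower

/-! ### The antisymmetrizer of the first tensor factors. -/

section Antisymmetrizer

variable {ι α β : Type} (e : ι ≃ α × β) {ℓ : ℕ}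

/-- Permute the first components of a tuple of pairs, leaving the second ones in place. -/
def permFst (σ : Equiv.Perm (Fin ℓ)) (x : Fin ℓ → ι) : Fin ℓ → ι :=
  fun i => e.symm ((e (x (σ i))).1, (e (x i)).2)

theorem permFst_permFst (σ τ : Equiv.Perm (Fin ℓ)) (x : Fin ℓ → ι) :
    permFst e τ (permFst e σ x) = permFst e (σ * τ) x := by
  ext i
  simp [permFst]

theorem permFst_one (x : Fin ℓ → ι) : permFst e 1 x = x := by
  ext i
  simp [permFst]

variable [DecidableEq ι]

/-- The matrix of the operator that permutes the first tensor factors of `(ℂ^α ⊗ ℂ^β)^{⊗ ℓ}`. -/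
def permMatrixFst (σ : Equiv.Perm (Fin ℓ)) : Matrix (Fin ℓ → ι) (Fin ℓ → ι) ℂ :=
  of fun x y => if y = permFst e σ x then 1 else 0

theorem permMatrixFst_conjTranspose (σ : Equiv.Perm (Fin ℓ)) :
    (permMatrixFst e σ)ᴴ = permMatrixFst e σ⁻¹ := by
  ext x y
  simp only [permMatrixFst, conjTranspose_apply, of_apply]
  have : x = permFst e σ y ↔ y = permFst e σ⁻¹ x := by
    constructor <;> rintro rfl <;> simp [permFst_permFst, permFst_one]
  rw [if_congr this rfl rfl]
  split_ifs <;> simp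

/-- The orthogonal projection of `(ℂ^α ⊗ ℂ^β)^{⊗ ℓ}` onto the vectors that are antisymmetric in the
first tensor factors. -/
noncomputable def antisymmetrizer (ℓ : ℕ) : Matrix (Fin ℓ → ι) (Fin ℓ → ι) ℂ :=
  (Nat.factorial ℓ : ℂ)⁻¹ •
    ∑ σ : Equiv.Perm (Fin ℓ), ((Equiv.Perm.sign σ : ℤ) : ℂ) • permMatrixFst e σ

theorem antisymmetrizer_isHermitian (ℓ : ℕ) : (antisymmetrizer e ℓ).IsHermitian := by
  rw [IsHermitian, antisymmetrizer, conjTranspose_smul, conjTranspose_sum]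
  simp only [conjTranspose_smul, permMatrixFst_conjTranspose]
  rw [← Equiv.sum_comp (Equiv.inv (Equiv.Perm (Fin ℓ)))]
  simp

variable [Fintype ι]

theorem permMatrixFst_mul (σ τ : Equiv.Perm (Fin ℓ)) :
    permMatrixFst e σ * permMatrixFst e τ = permMatrixFst e (σ * τ) := by
  ext x y
  rw [Matrix.mul_apply, Finset.sum_eq_single (permFst e σ x)]
  · simp [permMatrixFst, permFst_permFst]
  · intro z _ hz
    simp [permMatrixFst, hz]
  · simp

theorem permMatrixFst_mulVec (σ : Equiv.Perm (Fin ℓ)) (v : (Fin ℓ → ι) → ℂ) (x : Fin ℓ → ι) :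
    (permMatrixFst e σ *ᵥ v) x = v (permFst e σ x) := by
  simp [permMatrixFst, mulVec, dotProduct]

theorem permMatrixFst_mul_antisymmetrizer (σ : Equiv.Perm (Fin ℓ)) :
    permMatrixFst e σ * antisymmetrizer e ℓ =
      ((Equiv.Perm.sign σ : ℤ) : ℂ) • antisymmetrizer e ℓ := by
  rw [antisymmetrizer, Matrix.mul_smul, Matrix.mul_sum, smul_comm]
  congr 1
  rw [Finset.smul_sum]
  rw [← Equiv.sum_comp (Equiv.mulLeft σ) fun τ => ((Equiv.Perm.sign σ : ℤ) : ℂ) •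
    ((Equiv.Perm.sign τ : ℤ) : ℂ) • permMatrixFst e τ]
  refine Finset.sum_congr rfl fun τ _ => ?_
  rw [Matrix.mul_smul, permMatrixFst_mul, Equiv.coe_mulLeft, Equiv.Perm.sign_mul, smul_smul]
  congr 1
  rcases Int.units_eq_one_or (Equiv.Perm.sign σ) with h | h <;> simp [h]

theorem antisymmetrizer_mul_self (ℓ : ℕ) :
    antisymmetrizer e ℓ * antisymmetrizer e ℓ = antisymmetrizer e ℓ := by
  conv_lhs => rw [antisymmetrizer, Matrix.smul_mul, Matrix.sum_mul]
  have : ∀ σ : Equiv.Perm (Fin ℓ), ((Equiv.Perm.sign σ : ℤ) : ℂ) • permMatrixFst e σ *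
      antisymmetrizer e ℓ = antisymmetrizer e ℓ := by
    intro σ
    rw [Matrix.smul_mul, permMatrixFst_mul_antisymmetrizer, smul_smul]
    rcases Int.units_eq_one_or (Equiv.Perm.sign σ) with h | h <;> simp [h]
  have hne : (Nat.factorial ℓ : ℂ) ≠ 0 := by exact_mod_cast Nat.factorial_ne_zero ℓ
  change (Nat.factorial ℓ : ℂ)⁻¹ • ∑ σ : Equiv.Perm (Fin ℓ),
    ((Equiv.Perm.sign σ : ℤ) : ℂ) • permMatrixFst e σ * antisymmetrizer e ℓ = _
  rw [Finset.sum_congr rfl fun σ _ => this σ, Finset.sum_const, Finset.card_univ,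
    Fintype.card_perm, Fintype.card_fin, ← Nat.cast_smul_eq_nsmul ℂ, smul_smul,
    inv_mul_cancel₀ hne, one_smul]

/-- The partial trace over the second tensor factor. -/
def partialTrace [Fintype β] (ρ : Matrix ι ι ℂ) : Matrix α α ℂ :=
  of fun a a' => ∑ b, ρ (e.symm (a, b)) (e.symm (a', b))

/-- A permutation of the first components leaves the second ones paired with themselves; summing
over them gives the partial trace in each factor, and the signed sum over permutations becomes a
determinant. -/
theorem trace_antisymmetrizer_mul [Fintype α] [Fintype β] [DecidableEq α] (ρ : Matrix ι ι ℂ)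
    (ℓ : ℕ) : (antisymmetrizer e ℓ * tensorPow ρ ℓ).trace =
      (Nat.factorial ℓ : ℂ)⁻¹ *
        ∑ a : Fin ℓ → α, ((partialTrace e ρ).submatrix a a).det := by
  classical
  have hσ : ∀ σ : Equiv.Perm (Fin ℓ), (permMatrixFst e σ * tensorPow ρ ℓ).trace =
      ∑ a : Fin ℓ → α, ∏ i, partialTrace e ρ (a (σ i)) (a i) := by
    intro σ
    let E : (Fin ℓ → ι) ≃ (Fin ℓ → α) × (Fin ℓ → β) :=
      (Equiv.arrowCongr (Equiv.refl _) e).trans (Equiv.arrowProdEquivProdArrow _ _ _)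
    have hE : ∀ p i, E.symm p i = e.symm (p.1 i, p.2 i) := fun p i => rfl
    have h1 : (permMatrixFst e σ * tensorPow ρ ℓ).trace =
        ∑ x : Fin ℓ → ι, ∏ i, ρ (permFst e σ x i) (x i) := by
      simp [Matrix.trace, Matrix.mul_apply, permMatrixFst, tensorPow]
    rw [h1, ← E.symm.sum_comp, Fintype.sum_prod_type]
    refine Finset.sum_congr rfl fun a _ => ?_
    simp only [partialTrace, of_apply, Fintype.prod_sum]
    refine Finset.sum_congr rfl fun b _ => Finset.prod_congr rfl fun i _ => ?_
    simp [permFst, hE]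
  rw [antisymmetrizer, Matrix.smul_mul, trace_smul, Matrix.sum_mul, trace_sum, smul_eq_mul]
  congr 1
  simp only [Matrix.smul_mul, trace_smul, hσ, det_apply, submatrix_apply]
  rw [Finset.sum_comm]
  refine Finset.sum_congr rfl fun σ _ => ?_
  rw [Finset.smul_sum]
  refine Finset.sum_congr rfl fun a _ => ?_
  rw [Units.smul_def, zsmul_eq_mul, smul_eq_mul]

end Antisymmetrizer

/-! ### Adaptive tests and the consequence of perfect completeness. -/

section Tests

variable {ι : Type} [Fintype ι] [DecidableEq ι] {ℓ : ℕ}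

theorem sum_trace_povm {m : ℕ} (M : POVM (Fin ℓ → ι) m) {ρ : Matrix ι ι ℂ} (hρ : ρ ∈ states ι) :
    ∑ x, (M.op x * tensorPow ρ ℓ).trace.re = 1 := by
  rw [← Complex.re_sum, ← trace_sum, ← Matrix.sum_mul, M.sum_op, Matrix.one_mul,
    trace_tensorPow, hρ.2]
  simp

/-- The probability that an adaptive test rejects. -/
noncomputable def AdaptiveTest.rejectProb (ρ : Matrix ι ι ℂ) :
    {k : ℕ} → AdaptiveTest ι ℓ k → ℝ
  | _, .verdict accept => if accept then 0 else 1
  | _, .round M next => ∑ x, (M.op x * tensorPow ρ ℓ).trace.re * (next x).rejectProb ρ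

namespace AdaptiveTest

theorem acceptProb_add_rejectProb {ρ : Matrix ι ι ℂ} (hρ : ρ ∈ states ι) {k : ℕ}
    (T : AdaptiveTest ι ℓ k) : T.acceptProb ρ + T.rejectProb ρ = 1 := by
  induction T with
  | verdict a => cases a <;> simp [acceptProb, rejectProb]
  | round M next ih =>
    rw [acceptProb, rejectProb, ← Finset.sum_add_distrib]
    simp only [← mul_add, ih, mul_one]
    exact sum_trace_povm M hρ

theorem rejectProb_nonneg {ρ : Matrix ι ι ℂ} (hρ : ρ.PosSemidef) {k : ℕ}
    (T : AdaptiveTest ι ℓ k) : 0 ≤ T.rejectProb ρ := by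
  induction T with
  | verdict a => cases a <;> simp [rejectProb]
  | round M next ih =>
    exact Finset.sum_nonneg fun x _ =>
      mul_nonneg (trace_mul_nonneg (M.posSemidef x) (posSemidef_tensorPow hρ)) (ih x)

theorem acceptProb_nonneg {ρ : Matrix ι ι ℂ} (hρ : ρ.PosSemidef) {k : ℕ}
    (T : AdaptiveTest ι ℓ k) : 0 ≤ T.acceptProb ρ := by
  induction T with
  | verdict a => cases a <;> simp [acceptProb]
  | round M next ih =>
    exact Finset.sum_nonneg fun x _ =>
      mul_nonneg (trace_mul_nonneg (M.posSemidef x) (posSemidef_tensorPow hρ)) (ih x)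

/-- Rejection, unlike acceptance, has a target value (zero) that survives scaling, so completeness
can be used on unnormalized families parametrized by a vector space. -/
theorem rejectProb_smul (c : ℝ) (ρ : Matrix ι ι ℂ) {k : ℕ} (T : AdaptiveTest ι ℓ k) :
    T.rejectProb ((c : ℂ) • ρ) = (c ^ ℓ) ^ k * T.rejectProb ρ := by
  induction T with
  | verdict a => simp [rejectProb]
  | @round k m M next ih =>
    simp only [rejectProb, ih, tensorPow_smul, Matrix.mul_smul, trace_smul, Finset.mul_sum]
    refine Finset.sum_congr rfl fun x _ => ?_
    rw [smul_eq_mul, ← Complex.ofReal_pow, Complex.re_ofReal_mul]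
    ring

theorem analyticOnNhd_rejectProb {ρ : ℝ → Matrix ι ι ℂ}
    (h : ∀ i j, AnalyticOnNhd ℝ (fun t => ρ t i j) Set.univ) {k : ℕ} (T : AdaptiveTest ι ℓ k) :
    AnalyticOnNhd ℝ (fun t => T.rejectProb (ρ t)) Set.univ := by
  induction T with
  | verdict a => exact analyticOnNhd_const
  | round M next ih =>
    simp only [rejectProb]
    exact Finset.analyticOnNhd_fun_sum _ fun x _ => (analyticOnNhd_trace h _).mul (ih x)

/-- Perfect completeness on an irreducible family of states forces a lower bound on the acceptance
probability of every other state: if every effect that vanishes on the family is at most `p` on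
`ρ₀`, then `k` adaptive rounds accept `ρ₀` with probability at least `(1 - p) ^ k`. -/
theorem pow_le_acceptProb {V : Type} [Nonempty V] {ρ : V → Matrix ι ι ℂ}
    (hρ : ∀ θ, (ρ θ).PosSemidef)
    (hline : ∀ θ₀ θ₁, ∃ γ : ℝ → V, γ 0 = θ₀ ∧ γ 1 = θ₁ ∧
      ∀ i j, AnalyticOnNhd ℝ (fun t => ρ (γ t) i j) Set.univ)
    {ρ₀ : Matrix ι ι ℂ} (hρ₀ : ρ₀ ∈ states ι) {p : ℝ} (hp : p ≤ 1)
    (H : ∀ M : Matrix (Fin ℓ → ι) (Fin ℓ → ι) ℂ, M.PosSemidef → (1 - M).PosSemidef →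
      (∀ θ, (M * tensorPow (ρ θ) ℓ).trace.re = 0) → (M * tensorPow ρ₀ ℓ).trace.re ≤ p)
    {k : ℕ} (T : AdaptiveTest ι ℓ k) (hT : ∀ θ, T.rejectProb (ρ θ) = 0) :
    (1 - p) ^ k ≤ T.acceptProb ρ₀ := by
  induction T with
  | verdict a =>
    have := hT (Classical.arbitrary V)
    cases a <;> simp_all [rejectProb, acceptProb]
  | @round k m M next ih =>
    have hterm : ∀ θ x, (M.op x * tensorPow (ρ θ) ℓ).trace.re * (next x).rejectProb (ρ θ) = 0 := by
      intro θ x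
      have h0 : ∀ y ∈ Finset.univ,
          0 ≤ (M.op y * tensorPow (ρ θ) ℓ).trace.re * (next y).rejectProb (ρ θ) := fun y _ =>
        mul_nonneg (trace_mul_nonneg (M.posSemidef y) (posSemidef_tensorPow (hρ θ)))
          (rejectProb_nonneg (hρ θ) _)
      exact (Finset.sum_eq_zero_iff_of_nonneg h0).1 (hT θ) x (Finset.mem_univ x)
    -- If each factor were nonzero somewhere, a curve joining the two parameters would carry two
    -- nonzero analytic functions with zero product.
    have hdich : ∀ x, (∀ θ, (M.op x * tensorPow (ρ θ) ℓ).trace.re = 0) ∨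
        ∀ θ, (next x).rejectProb (ρ θ) = 0 := by
      intro x
      by_contra! hcon
      obtain ⟨⟨θ₀, h₀⟩, θ₁, h₁⟩ := hcon
      obtain ⟨γ, hγ₀, hγ₁, hγ⟩ := hline θ₀ θ₁
      rcases (analyticOnNhd_trace hγ (M.op x)).eq_zero_or_eq_zero_of_mul_eq_zero
        (analyticOnNhd_rejectProb hγ (next x)) (fun t _ => hterm (γ t) x)
        isPreconnected_univ with h | h
      · exact h₀ (hγ₀ ▸ h 0 (Set.mem_univ _))
      · exact h₁ (hγ₁ ▸ h 1 (Set.mem_univ _))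
    classical
    -- The outcomes vanishing on the family are pooled into one effect, so that their total
    -- probability on `ρ₀` is at most `p`. Every other outcome leads to a test to which the
    -- induction hypothesis applies.
    let B : Finset (Fin m) := {x | ∀ θ, (M.op x * tensorPow (ρ θ) ℓ).trace.re = 0}
    have hB : ∑ x ∈ B, (M.op x * tensorPow ρ₀ ℓ).trace.re ≤ p := by
      rw [← Complex.re_sum, ← trace_sum, ← Matrix.sum_mul]
      refine H _ (posSemidef_sum _ fun x _ => M.posSemidef x) ?_ fun θ => ?_
      · rw [← M.sum_op, ← Finset.sum_compl_add_sum B, add_sub_cancel_right]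
        exact posSemidef_sum _ fun x _ => M.posSemidef x
      · rw [Matrix.sum_mul, trace_sum, Complex.re_sum]
        exact Finset.sum_eq_zero fun x hx => (Finset.mem_filter.1 hx).2 θ
    have hnn : ∀ x, 0 ≤ (M.op x * tensorPow ρ₀ ℓ).trace.re := fun x =>
      trace_mul_nonneg (M.posSemidef x) (posSemidef_tensorPow hρ₀.1)
    have hpow : 0 ≤ (1 - p) ^ k := pow_nonneg (by linarith) k
    calc (1 - p) ^ (k + 1) = (1 - p) * (1 - p) ^ k := pow_succ' _ _
      _ ≤ (∑ x ∈ Bᶜ, (M.op x * tensorPow ρ₀ ℓ).trace.re) * (1 - p) ^ k := by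
        gcongr
        have := sum_trace_povm M hρ₀
        rw [← Finset.sum_compl_add_sum B] at this
        linarith
      _ ≤ ∑ x ∈ Bᶜ, (M.op x * tensorPow ρ₀ ℓ).trace.re * (next x).acceptProb ρ₀ := by
        rw [Finset.sum_mul]
        refine Finset.sum_le_sum fun x hx => mul_le_mul_of_nonneg_left (ih x ?_) (hnn x)
        exact (hdich x).resolve_left fun h => Finset.mem_compl.1 hx (by simpa [B] using h)
      _ ≤ _ := Finset.sum_le_sum_of_subset_of_nonneg (Finset.subset_univ _) fun x _ _ =>
        mul_nonneg (hnn x) (acceptProb_nonneg hρ₀.1 _)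

/-- The test that rejects in any case. -/
def alwaysReject (ι : Type) [Fintype ι] [DecidableEq ι] (ℓ : ℕ) : (k : ℕ) → AdaptiveTest ι ℓ k
  | 0 => .verdict false
  | k + 1 => .round (m := 1) ⟨fun _ => 1, fun _ => .one, by simp⟩ fun _ => alwaysReject ι ℓ k

theorem acceptProb_alwaysReject (ρ : Matrix ι ι ℂ) (k : ℕ) :
    (alwaysReject ι ℓ k).acceptProb ρ = 0 := by
  induction k with
  | zero => simp [alwaysReject, acceptProb]
  | succ k ih => simp [alwaysReject, acceptProb, ih]

/-- Repeat a projective measurement `{Q, 1 - Q}` and reject as soon as the outcome `Q` occurs. -/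
noncomputable def rejectOn {Q : Matrix (Fin ℓ → ι) (Fin ℓ → ι) ℂ} (hQ : Q.IsHermitian)
    (hQ2 : Q * Q = Q) : (k : ℕ) → AdaptiveTest ι ℓ k
  | 0 => .verdict true
  | k + 1 => .round (m := 2) ⟨![Q, 1 - Q], by
      simpa [Fin.forall_fin_two] using
        ⟨posSemidef_of_projection hQ hQ2, posSemidef_one_sub_of_projection hQ hQ2⟩,
      by simp⟩ ![alwaysReject ι ℓ k, rejectOn hQ hQ2 k]

theorem acceptProb_rejectOn {Q : Matrix (Fin ℓ → ι) (Fin ℓ → ι) ℂ} (hQ : Q.IsHermitian)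
    (hQ2 : Q * Q = Q) {ρ : Matrix ι ι ℂ} (hρ : ρ ∈ states ι) (k : ℕ) :
    (rejectOn hQ hQ2 k).acceptProb ρ = (1 - (Q * tensorPow ρ ℓ).trace.re) ^ k := by
  induction k with
  | zero => simp [rejectOn, acceptProb]
  | succ k ih =>
    have : ((1 - Q) * tensorPow ρ ℓ).trace.re = 1 - (Q * tensorPow ρ ℓ).trace.re := by
      rw [Matrix.sub_mul, trace_sub, Matrix.one_mul, trace_tensorPow, hρ.2]
      simp
    rw [rejectOn, acceptProb, Fin.sum_univ_two, pow_succ', ← ih]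
    simp [acceptProb_alwaysReject, this]

end AdaptiveTest

end Tests

/-! ### Comparing an effect with a projection. -/

section VanishingEffects

variable {κ : Type} [Fintype κ]

theorem trace_mul_ketBra (M : Matrix κ κ ℂ) (v : κ → ℂ) :
    (M * ketBra v).trace = star v ⬝ᵥ (M *ᵥ v) := by
  rw [ketBra, mul_vecMulVec, trace_vecMulVec, dotProduct_comm]

theorem mulVec_eq_zero_of_re_trace_eq_zero {M : Matrix κ κ ℂ} (hM : M.PosSemidef) {v : κ → ℂ}
    (h : (M * ketBra v).trace.re = 0) : M *ᵥ v = 0 := by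
  classical
  rw [trace_mul_ketBra] at h
  rw [← hM.dotProduct_mulVec_zero_iff]
  exact Complex.ext h (Complex.le_def.1 (hM.dotProduct_mulVec_nonneg v)).2.symm

variable [DecidableEq κ]

/-- With `M Q v = M v` one gets `⟨v, M v⟩ = ⟨Q v, M Q v⟩ ≤ ⟨Q v, Q v⟩ = ⟨v, Q v⟩`. A condition at
the single vector `v` is all that is available for Schmidt rank. -/
theorem re_trace_mul_ketBra_le_of_mulVec_eq {M Q : Matrix κ κ ℂ} (hM : M.PosSemidef)
    (hM1 : (1 - M).PosSemidef) (hQ : Q.IsHermitian) (hQ2 : Q * Q = Q) {v : κ → ℂ}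
    (h : M *ᵥ (Q *ᵥ v) = M *ᵥ v) : (M * ketBra v).trace.re ≤ (Q * ketBra v).trace.re := by
  have hadj : ∀ {N : Matrix κ κ ℂ}, N.IsHermitian → ∀ u w : κ → ℂ,
      star u ⬝ᵥ (N *ᵥ w) = star (N *ᵥ u) ⬝ᵥ w := by
    intro N hN u w
    rw [star_mulVec, hN.eq, dotProduct_mulVec]
  rw [trace_mul_ketBra, trace_mul_ketBra]
  have h1 : star v ⬝ᵥ (M *ᵥ v) = star (Q *ᵥ v) ⬝ᵥ (M *ᵥ (Q *ᵥ v)) := by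
    rw [hadj hM.isHermitian, ← h, ← hadj hM.isHermitian, h, ← hadj hQ]
  have h2 : star v ⬝ᵥ (Q *ᵥ v) = star (Q *ᵥ v) ⬝ᵥ (Q *ᵥ v) := by
    rw [← hadj hQ, mulVec_mulVec, hQ2]
  have h3 := (Complex.le_def.1 (hM1.dotProduct_mulVec_nonneg (Q *ᵥ v))).1
  rw [sub_mulVec, one_mulVec, dotProduct_sub] at h3
  rw [h1, h2]
  simpa using h3

/-- The hypothesis gives `M = Q M Q`, hence `Q - M = Q (1 - M) Q`. -/
theorem posSemidef_sub_of_mul_eq {M Q : Matrix κ κ ℂ} (hM : M.PosSemidef)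
    (hM1 : (1 - M).PosSemidef) (hQ : Q.IsHermitian) (hQ2 : Q * Q = Q) (h : M * Q = M) :
    (Q - M).PosSemidef := by
  have h' : Q * M = M := by
    have := congrArg conjTranspose h
    rwa [conjTranspose_mul, hQ.eq, hM.isHermitian.eq] at this
  have := hM1.mul_mul_conjTranspose_same Q
  rwa [hQ.eq, Matrix.mul_sub, Matrix.sub_mul, Matrix.mul_one, hQ2, h', h] at this

end VanishingEffects

/-! ### Effects vanishing on all states of rank at most `r`. -/

section Rank

variable {ι : Type} {r : ℕ}

theorem tensorPow_mul_conjTranspose_self (A : Matrix ι (Fin r) ℂ) (ℓ : ℕ) :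
    tensorPow (A * Aᴴ) ℓ =
      ∑ s : Fin ℓ → Fin r, ketBra fun x : Fin ℓ → ι => ∏ k, A (x k) (s k) := by
  ext x y
  simp [tensorPow, Matrix.mul_apply, Fintype.prod_sum, Matrix.sum_apply, ketBra, vecMulVec_apply,
    Finset.prod_mul_distrib]

/-- The tensor product of vectors, as a multilinear map. -/
def tensorMultilinear (ι : Type) (ℓ : ℕ) :
    MultilinearMap ℂ (fun _ : Fin ℓ => ι → ℂ) ((Fin ℓ → ι) → ℂ) :=
  MultilinearMap.pi fun x => (MultilinearMap.mkPiAlgebra ℂ (Fin ℓ) ℂ).compLinearMap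
    fun k => LinearMap.proj (x k)

theorem tensorMultilinear_apply (ℓ : ℕ) (a : Fin ℓ → ι → ℂ) :
    tensorMultilinear ι ℓ a = fun x => ∏ k, a k (x k) := by
  ext x
  simp [tensorMultilinear]

variable [Fintype ι]

theorem mulVec_tensor_eq_zero {M : Matrix (Fin (r + 1) → ι) (Fin (r + 1) → ι) ℂ}
    (hM : M.PosSemidef)
    (h : ∀ A : Matrix ι (Fin r) ℂ, (M * tensorPow (A * Aᴴ) (r + 1)).trace.re = 0)
    (a : Fin (r + 1) → ι → ℂ) {i j : Fin (r + 1)} (hij : i ≠ j) (haij : a i = a j) :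
    (M *ᵥ fun x => ∏ k, a k (x k)) = 0 := by
  -- Omitting the repeated vector `a j` leaves `r` columns, and the given product is still a product
  -- of columns of `A`. It is therefore one of the nonnegative terms whose sum is zero.
  let A : Matrix ι (Fin r) ℂ := of fun x s => a (j.succAbove s) x
  have hA := h A
  rw [tensorPow_mul_conjTranspose_self, Matrix.mul_sum, trace_sum, Complex.re_sum] at hA
  have h0 := (Finset.sum_eq_zero_iff_of_nonneg fun s _ =>
    trace_mul_nonneg hM (posSemidef_vecMulVec_self_star _)).1 hA
  obtain ⟨i', hi'⟩ := Fin.exists_succAbove_eq hij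
  have hs : ∀ k, ∃ s, a (j.succAbove s) = a k := by
    intro k
    by_cases hk : k = j
    · exact ⟨i', by rw [hi', hk, haij]⟩
    · obtain ⟨s, hs⟩ := Fin.exists_succAbove_eq hk
      exact ⟨s, by rw [hs]⟩
  choose s hs using hs
  have := mulVec_eq_zero_of_re_trace_eq_zero hM (h0 s (Finset.mem_univ s))
  simpa [A, hs] using this

variable [DecidableEq ι]

theorem mul_antisymmetrizer_of_forall {α β : Type} (e : ι ≃ α × β) {ℓ : ℕ}
    {M : Matrix (Fin ℓ → ι) (Fin ℓ → ι) ℂ}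
    (h : ∀ σ, M * permMatrixFst e σ = ((Equiv.Perm.sign σ : ℤ) : ℂ) • M) :
    M * antisymmetrizer e ℓ = M := by
  have hne : (Nat.factorial ℓ : ℂ) ≠ 0 := by exact_mod_cast Nat.factorial_ne_zero ℓ
  have h' : ∀ σ : Equiv.Perm (Fin ℓ),
      M * ((Equiv.Perm.sign σ : ℤ) : ℂ) • permMatrixFst e σ = M := by
    intro σ
    rw [Matrix.mul_smul, h, smul_smul]
    rcases Int.units_eq_one_or (Equiv.Perm.sign σ) with h | h <;> simp [h]
  rw [antisymmetrizer, Matrix.mul_smul, Matrix.mul_sum, Finset.sum_congr rfl fun σ _ => h' σ,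
    Finset.sum_const, Finset.card_univ, Fintype.card_perm, Fintype.card_fin,
    ← Nat.cast_smul_eq_nsmul ℂ, smul_smul, inv_mul_cancel₀ hne, one_smul]

/-- The map sending `a` to `M` applied to the tensor product of the `a k` vanishes when two
arguments agree, so it is alternating; evaluating it on basis vectors gives the sign rule for the
columns of `M`. -/
theorem mul_permMatrixFst_of_vanishing {M : Matrix (Fin (r + 1) → ι) (Fin (r + 1) → ι) ℂ}
    (hM : M.PosSemidef)
    (h : ∀ A : Matrix ι (Fin r) ℂ, (M * tensorPow (A * Aᴴ) (r + 1)).trace.re = 0)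
    (σ : Equiv.Perm (Fin (r + 1))) :
    M * permMatrixFst (Equiv.prodPUnit ι).symm σ = ((Equiv.Perm.sign σ : ℤ) : ℂ) • M := by
  let G : (ι → ℂ) [⋀^Fin (r + 1)]→ₗ[ℂ] ((Fin (r + 1) → ι) → ℂ) :=
    { M.mulVecLin.compMultilinearMap (tensorMultilinear ι (r + 1)) with
      map_eq_zero_of_eq' := fun a i j haij hij => by
        simpa [tensorMultilinear_apply] using mulVec_tensor_eq_zero hM h a hij haij }
  have hG : ∀ y z, M z y = G (fun k => Pi.single (y k) 1) z := by
    intro y z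
    have : G (fun k => Pi.single (y k) 1) = M *ᵥ Pi.single y 1 := by
      change M *ᵥ (tensorMultilinear ι (r + 1) _) = _
      rw [tensorMultilinear_apply]
      congr 1
      ext x
      simp only [Pi.single_apply, Finset.prod_ite_zero, funext_iff]
      simp
    rw [this, mulVec_single_one]
    rfl
  ext z y
  have h1 : (M * permMatrixFst (Equiv.prodPUnit ι).symm σ) z y = M z (y ∘ σ.symm) := by
    rw [Matrix.mul_apply, Finset.sum_eq_single (y ∘ σ.symm)]
    · have : y = permFst (Equiv.prodPUnit ι).symm σ (y ∘ σ.symm) := by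
        ext k
        simp [permFst]
      simp [permMatrixFst, ← this]
    · intro x _ hx
      have : y ≠ permFst (Equiv.prodPUnit ι).symm σ x := by
        rintro rfl
        refine hx ?_
        ext k
        simp [permFst]
      simp [permMatrixFst, this]
    · simp
  have := congrFun (G.map_perm (fun k => Pi.single (y k) 1) σ.symm) z
  rw [h1, Matrix.smul_apply, hG, hG y z, ← Equiv.Perm.sign_symm σ]
  simpa [Function.comp_def, Units.smul_def] using this

/-- Among the effects that vanish on all states of rank at most `r`, the antisymmetrizer is the
largest one. -/
theorem trace_mul_le_of_vanishing_on_rank {M : Matrix (Fin (r + 1) → ι) (Fin (r + 1) → ι) ℂ}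
    (hM : M.PosSemidef) (hM1 : (1 - M).PosSemidef)
    (h : ∀ A : Matrix ι (Fin r) ℂ, (M * tensorPow (A * Aᴴ) (r + 1)).trace.re = 0)
    {ρ : Matrix ι ι ℂ} (hρ : ρ.PosSemidef) :
    (M * tensorPow ρ (r + 1)).trace.re ≤
      (antisymmetrizer (Equiv.prodPUnit ι).symm (r + 1) * tensorPow ρ (r + 1)).trace.re := by
  have hle := posSemidef_sub_of_mul_eq hM hM1 (antisymmetrizer_isHermitian _ _)
    (antisymmetrizer_mul_self _ _)
    (mul_antisymmetrizer_of_forall _ (mul_permMatrixFst_of_vanishing hM h))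
  have := trace_mul_nonneg hle (posSemidef_tensorPow (ℓ := r + 1) hρ)
  rw [Matrix.sub_mul, trace_sub, Complex.sub_re] at this
  linarith

end Rank

/-! ### Polarization by averaging over signs. -/

section Polarization

theorem sum_signs_mul_prod {n : ℕ} (s : Fin n → Fin n) :
    ∑ t : Fin n → ℤˣ, (∏ k, ((t k : ℤ) : ℂ)) * ∏ i, ((t (s i) : ℤ) : ℂ) =
      if Function.Bijective s then 2 ^ n else 0 := by
  split_ifs with hs
  · have : ∀ t : Fin n → ℤˣ, (∏ k, ((t k : ℤ) : ℂ)) * ∏ i, ((t (s i) : ℤ) : ℂ) = 1 := by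
      intro t
      rw [hs.prod_comp fun k => ((t k : ℤ) : ℂ), ← Finset.prod_mul_distrib]
      refine Finset.prod_eq_one fun k _ => ?_
      rcases Int.units_eq_one_or (t k) with h | h <;> simp [h]
    simp [this]
  · obtain ⟨k, hk⟩ : ∃ k, ∀ i, s i ≠ k := by
      by_contra! hcon
      exact hs (Finite.surjective_iff_bijective.1 hcon)
    -- Flipping the sign at an index missed by `s` negates every summand, so the sum equals its own
    -- negative.
    have hneg := Equiv.sum_comp (Equiv.mulLeft (Pi.mulSingle k (-1) : Fin n → ℤˣ))
      fun t : Fin n → ℤˣ => (∏ k, ((t k : ℤ) : ℂ)) * ∏ i, ((t (s i) : ℤ) : ℂ)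
    have h1 : ∏ x, (((Pi.mulSingle k (-1) : Fin n → ℤˣ) x : ℤ) : ℂ) = -1 := by
      rw [Finset.prod_eq_single k]
      · simp
      · intro b _ hb
        simp [Pi.mulSingle_eq_of_ne hb]
      · simp
    have h2 : ∀ i, (Pi.mulSingle k (-1) : Fin n → ℤˣ) (s i) = 1 := fun i =>
      Pi.mulSingle_eq_of_ne (hk i) _
    simp only [Equiv.coe_mulLeft, Pi.mul_apply, h2, Units.val_mul, Int.cast_mul,
      Finset.prod_mul_distrib, h1, one_mul, neg_mul, Finset.sum_neg_distrib] at hneg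
    linear_combination (-1 / 2 : ℂ) * hneg

theorem sum_ite_bijective {n : ℕ} (f : (Fin n → Fin n) → ℂ) :
    ∑ s : Fin n → Fin n, (if Function.Bijective s then f s else 0) =
      ∑ σ : Equiv.Perm (Fin n), f σ := by
  rw [← Finset.sum_filter]
  symm
  exact Finset.sum_bij (fun σ _ => ⇑σ)
    (fun σ _ => Finset.mem_filter.2 ⟨Finset.mem_univ _, σ.bijective⟩)
    (fun σ _ τ _ h => DFunLike.coe_injective h)
    (fun s hs => ⟨Equiv.ofBijective s (Finset.mem_filter.1 hs).2, Finset.mem_univ _, rfl⟩)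
    (fun _ _ => rfl)

/-- The polarization identity for tensor powers of vectors. -/
theorem sum_signs_smul_tensor {κ : Type} {n : ℕ} (u : Fin n → κ → ℂ) (x : Fin n → κ) :
    ∑ t : Fin n → ℤˣ, (∏ k, ((t k : ℤ) : ℂ)) * ∏ i, ∑ k, ((t k : ℤ) : ℂ) * u k (x i) =
      2 ^ n * ∑ σ : Equiv.Perm (Fin n), ∏ i, u (σ i) (x i) := by
  rw [← sum_ite_bijective fun s => ∏ i, u (s i) (x i)]
  simp only [Fintype.prod_sum, Finset.mul_sum]
  rw [Finset.sum_comm]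
  refine Finset.sum_congr rfl fun s _ => ?_
  simp only [Finset.prod_mul_distrib, ← mul_assoc]
  rw [← Finset.sum_mul, sum_signs_mul_prod]
  split_ifs <;> simp

end Polarization

/-! ### Effects vanishing on all vectors of Schmidt rank at most `r`. -/

section SchmidtRank

variable {α β : Type} {r : ℕ}

/-- The bipartite vector with coefficient matrix `A * Bᵀ`. -/
def factorVec (A : Matrix α (Fin r) ℂ) (B : Matrix β (Fin r) ℂ) : α × β → ℂ :=
  fun p => ∑ s, A p.1 s * B p.2 s

/-- The sum of all permutations of `⨂ₖ (aₖ ⊗ bₖ)`, as a multilinear map of `a`. -/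
noncomputable def symTensor {n : ℕ} (b : Fin n → β → ℂ) :
    MultilinearMap ℂ (fun _ : Fin n => α → ℂ) ((Fin n → α × β) → ℂ) :=
  MultilinearMap.pi fun x => ∑ τ : Equiv.Perm (Fin n), (∏ k, b k (x (τ k)).2) •
    (MultilinearMap.mkPiAlgebra ℂ (Fin n) ℂ).compLinearMap fun k => LinearMap.proj (x (τ k)).1

theorem symTensor_apply {n : ℕ} (b : Fin n → β → ℂ) (a : Fin n → α → ℂ) (x : Fin n → α × β) :
    symTensor b a x =
      ∑ τ : Equiv.Perm (Fin n), ∏ k, a k (x (τ k)).1 * b k (x (τ k)).2 := by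
  simp [symTensor, Finset.prod_mul_distrib, mul_comm]

variable [Fintype α] [Fintype β]

/-- By polarization, `symTensor b a` is a combination of powers of the vectors `∑ₖ ± aₖ ⊗ bₖ`. If `a
i = a j`, two terms merge and each of these vectors has Schmidt rank at most `r`. -/
theorem mulVec_symTensor_eq_zero
    {M : Matrix (Fin (r + 1) → α × β) (Fin (r + 1) → α × β) ℂ} (hM : M.PosSemidef)
    (h : ∀ (A : Matrix α (Fin r) ℂ) (B : Matrix β (Fin r) ℂ),
      (M * tensorPow (ketBra (factorVec A B)) (r + 1)).trace.re = 0)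
    (a : Fin (r + 1) → α → ℂ) (b : Fin (r + 1) → β → ℂ) {i j : Fin (r + 1)} (hij : i ≠ j)
    (haij : a i = a j) : M *ᵥ symTensor b a = 0 := by
  let u : Fin (r + 1) → α × β → ℂ := fun k p => a k p.1 * b k p.2
  have hvec : ∀ t : Fin (r + 1) → ℤˣ,
      (M *ᵥ fun x => ∏ l, ∑ k, ((t k : ℤ) : ℂ) * u k (x l)) = 0 := by
    intro t
    obtain ⟨i', hi'⟩ := Fin.exists_succAbove_eq hij
    let A : Matrix α (Fin r) ℂ := of fun p s => a (j.succAbove s) p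
    -- Column `i'` corresponds to the index `i`; it absorbs the term of the omitted index `j`.
    let B : Matrix β (Fin r) ℂ := of fun q s => ((t (j.succAbove s) : ℤ) : ℂ) *
      b (j.succAbove s) q + if s = i' then ((t j : ℤ) : ℂ) * b j q else 0
    have hAB : factorVec A B = fun p => ∑ k, ((t k : ℤ) : ℂ) * u k p := by
      ext p
      simp only [factorVec, A, B, u, of_apply, mul_add, Finset.sum_add_distrib, mul_ite, mul_zero,
        Finset.sum_ite_eq', Finset.mem_univ, if_true, hi', haij]
      rw [Fin.sum_univ_succAbove _ j, add_comm]
      congr 1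
      · ring
      · exact Finset.sum_congr rfl fun s _ => by ring
    have := h A B
    rw [tensorPow_ketBra, hAB] at this
    exact mulVec_eq_zero_of_re_trace_eq_zero hM this
  have hsym : symTensor b a = ((2 : ℂ) ^ (r + 1))⁻¹ •
      ∑ t : Fin (r + 1) → ℤˣ, (∏ k, ((t k : ℤ) : ℂ)) •
        fun x : Fin (r + 1) → α × β => ∏ l, ∑ k, ((t k : ℤ) : ℂ) * u k (x l) := by
    ext x
    rw [Pi.smul_apply, Finset.sum_apply]
    simp only [Pi.smul_apply, smul_eq_mul]
    rw [sum_signs_smul_tensor, ← mul_assoc, inv_mul_cancel₀ (by positivity), one_mul,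
      symTensor_apply, ← Equiv.sum_comp (Equiv.inv (Equiv.Perm (Fin (r + 1))))]
    refine Finset.sum_congr rfl fun τ _ => ?_
    rw [← Equiv.prod_comp τ]
    refine Finset.prod_congr rfl fun k _ => ?_
    simp [u]
  rw [hsym, mulVec_smul, mulVec_sum]
  simp [mulVec_smul, hvec]

variable [DecidableEq α] [DecidableEq β]

/-- Expand `v^{⊗ n}` in product basis vectors, permute their first components by `σ` and symmetrize.
Since `v^{⊗ n}` is symmetric, the outcome is a sum over the conjugates of `σ⁻¹`. -/
theorem sum_smul_symTensor_single {n : ℕ} (v : α × β → ℂ) (σ : Equiv.Perm (Fin n)) :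
    (∑ z : Fin n → α × β, (∏ k, v (z k)) •
      symTensor (fun k => Pi.single (z k).2 (1 : ℂ)) (fun k => Pi.single (z (σ k)).1 (1 : ℂ))) =
      ∑ τ : Equiv.Perm (Fin n),
        permMatrixFst (Equiv.refl (α × β)) (τ * σ⁻¹ * τ⁻¹) *ᵥ fun x => ∏ k, v (x k) := by
  ext x
  rw [Finset.sum_apply, Finset.sum_apply]
  simp only [Pi.smul_apply, smul_eq_mul, symTensor_apply, Finset.mul_sum, permMatrixFst_mulVec]
  rw [Finset.sum_comm]
  refine Finset.sum_congr rfl fun τ _ => ?_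
  -- For fixed `x` and `τ` this is the only basis tuple with a nonzero contribution.
  let y : Fin n → α × β := fun k => ((x (τ (σ⁻¹ k))).1, (x (τ k)).2)
  rw [Finset.sum_eq_single y]
  · have h1 : ∏ k, (Pi.single (y (σ k)).1 (1 : ℂ) : α → ℂ) (x (τ k)).1 *
        (Pi.single (y k).2 (1 : ℂ) : β → ℂ) (x (τ k)).2 = 1 :=
      Finset.prod_eq_one fun k _ => by simp [y]
    rw [h1, mul_one]
    refine (Finset.prod_congr rfl fun k _ => ?_).trans (Equiv.prod_comp τ _)
    simp [y, permFst]
  · intro z _ hz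
    refine mul_eq_zero_of_right _ ?_
    by_contra hne
    rw [← ne_eq, Finset.prod_ne_zero_iff] at hne
    have hne' : ∀ k, (x (τ k)).1 = (z (σ k)).1 ∧ (x (τ k)).2 = (z k).2 := by
      intro k
      have := mul_ne_zero_iff.1 (hne k (Finset.mem_univ k))
      constructor
      · by_contra hc
        exact this.1 (Pi.single_eq_of_ne hc _)
      · by_contra hc
        exact this.2 (Pi.single_eq_of_ne hc _)
    refine hz (funext fun k => Prod.ext ?_ (hne' k).2.symm)
    have := (hne' (σ⁻¹ k)).1
    simpa [y] using this.symm
  · simp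

/-- Composed with `symTensor`, `M` is alternating in the first components, so permuting these in the
expansion of `v^{⊗ (r + 1)}` produces a sign. The signed sum over permutations is then computed in
two ways. -/
theorem mulVec_antisymmetrizer_mulVec
    {M : Matrix (Fin (r + 1) → α × β) (Fin (r + 1) → α × β) ℂ} (hM : M.PosSemidef)
    (h : ∀ (A : Matrix α (Fin r) ℂ) (B : Matrix β (Fin r) ℂ),
      (M * tensorPow (ketBra (factorVec A B)) (r + 1)).trace.re = 0) (v : α × β → ℂ) :
    (M *ᵥ (antisymmetrizer (Equiv.refl (α × β)) (r + 1) *ᵥ fun x => ∏ k, v (x k))) =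
      M *ᵥ fun x => ∏ k, v (x k) := by
  set w : (Fin (r + 1) → α × β) → ℂ := fun x => ∏ k, v (x k) with hw
  set e := Equiv.refl (α × β)
  let G : (Fin (r + 1) → β → ℂ) → (α → ℂ) [⋀^Fin (r + 1)]→ₗ[ℂ] ((Fin (r + 1) → α × β) → ℂ) :=
    fun b => { M.mulVecLin.compMultilinearMap (symTensor b) with
      map_eq_zero_of_eq' := fun a i j haij hij => mulVec_symTensor_eq_zero hM h a b hij haij }
  have hG : ∀ b a, G b a = M *ᵥ symTensor b a := fun b a => rfl
  have hperm : ∀ σ : Equiv.Perm (Fin (r + 1)),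
      (M *ᵥ ∑ τ : Equiv.Perm (Fin (r + 1)), permMatrixFst e (τ * σ⁻¹ * τ⁻¹) *ᵥ w) =
        ((Equiv.Perm.sign σ : ℤ) : ℂ) • (Nat.factorial (r + 1) : ℂ) • (M *ᵥ w) := by
    have hone : (M *ᵥ ∑ z : Fin (r + 1) → α × β, (∏ k, v (z k)) •
      symTensor (fun k => Pi.single (z k).2 (1 : ℂ)) (fun k => Pi.single (z k).1 (1 : ℂ))) =
        (Nat.factorial (r + 1) : ℂ) • (M *ᵥ w) := by
      have := sum_smul_symTensor_single v (1 : Equiv.Perm (Fin (r + 1)))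
      simp only [Equiv.Perm.one_apply] at this
      rw [this]
      have h1 : ∀ τ : Equiv.Perm (Fin (r + 1)), permMatrixFst e (τ * 1⁻¹ * τ⁻¹) *ᵥ w = w := by
        intro τ
        ext x
        rw [permMatrixFst_mulVec]
        simp [permFst_one]
      rw [Finset.sum_congr rfl fun τ _ => h1 τ, Finset.sum_const, Finset.card_univ,
        Fintype.card_perm, Fintype.card_fin, ← Nat.cast_smul_eq_nsmul ℂ, mulVec_smul]
    intro σ
    rw [← sum_smul_symTensor_single v σ, ← hone, mulVec_sum, mulVec_sum, Finset.smul_sum]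
    refine Finset.sum_congr rfl fun z _ => ?_
    rw [mulVec_smul, mulVec_smul, smul_comm, ← hG, ← hG]
    congr 1
    have := (G fun k => Pi.single (z k).2 (1 : ℂ)).map_perm
      (fun k => Pi.single (z k).1 (1 : ℂ)) σ
    rw [Units.smul_def, ← Int.cast_smul_eq_zsmul ℂ] at this
    exact this
  have hne : (Nat.factorial (r + 1) : ℂ) ≠ 0 := by exact_mod_cast Nat.factorial_ne_zero (r + 1)
  have hsum : ∑ σ : Equiv.Perm (Fin (r + 1)), ((Equiv.Perm.sign σ : ℤ) : ℂ) •
      (M *ᵥ ∑ τ : Equiv.Perm (Fin (r + 1)), permMatrixFst e (τ * σ⁻¹ * τ⁻¹) *ᵥ w) =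
      (Nat.factorial (r + 1) : ℂ) • (Nat.factorial (r + 1) : ℂ) •
        (M *ᵥ (antisymmetrizer e (r + 1) *ᵥ w)) := by
    -- The substitution `σ ↦ τ σ⁻¹ τ⁻¹` is a sign-preserving bijection, so each `τ` contributes the
    -- same antisymmetrizer.
    have hτ : ∀ τ : Equiv.Perm (Fin (r + 1)), ∑ σ : Equiv.Perm (Fin (r + 1)),
        ((Equiv.Perm.sign σ : ℤ) : ℂ) • (M *ᵥ (permMatrixFst e (τ * σ⁻¹ * τ⁻¹) *ᵥ w)) =
        (Nat.factorial (r + 1) : ℂ) • (M *ᵥ (antisymmetrizer e (r + 1) *ᵥ w)) := by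
      intro τ
      rw [antisymmetrizer, smul_mulVec, mulVec_smul, smul_smul, mul_inv_cancel₀ hne, one_smul,
        sum_mulVec, mulVec_sum, ← Equiv.sum_comp ((Equiv.inv _).trans (MulAut.conj τ).toEquiv)
          fun σ => M *ᵥ (((Equiv.Perm.sign σ : ℤ) : ℂ) • permMatrixFst e σ) *ᵥ w]
      refine Finset.sum_congr rfl fun σ _ => ?_
      rw [smul_mulVec, mulVec_smul]
      rcases Int.units_eq_one_or (Equiv.Perm.sign τ) with h | h <;> simp [h]
    simp only [mulVec_sum, Finset.smul_sum]
    rw [Finset.sum_comm, Finset.sum_congr rfl fun τ _ => hτ τ, Finset.sum_const, Finset.card_univ,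
      Fintype.card_perm, Fintype.card_fin, ← Nat.cast_smul_eq_nsmul ℂ]
  have hsign : ∀ σ : Equiv.Perm (Fin (r + 1)), ((Equiv.Perm.sign σ : ℤ) : ℂ) •
      ((Equiv.Perm.sign σ : ℤ) : ℂ) • (Nat.factorial (r + 1) : ℂ) • (M *ᵥ w) =
        (Nat.factorial (r + 1) : ℂ) • (M *ᵥ w) := by
    intro σ
    rw [smul_smul]
    rcases Int.units_eq_one_or (Equiv.Perm.sign σ) with h | h <;> simp [h]
  simp only [hperm, hsign] at hsum
  rw [Finset.sum_const, Finset.card_univ, Fintype.card_perm, Fintype.card_fin,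
    ← Nat.cast_smul_eq_nsmul ℂ] at hsum
  exact (smul_right_injective _ hne (smul_right_injective _ hne hsum)).symm

/-- Among the effects that vanish on all pure states of Schmidt rank at most `r`, the
antisymmetrizer of the first tensor factors is the largest one. -/
theorem trace_mul_le_of_vanishing_on_schmidtRank
    {M : Matrix (Fin (r + 1) → α × β) (Fin (r + 1) → α × β) ℂ} (hM : M.PosSemidef)
    (hM1 : (1 - M).PosSemidef)
    (h : ∀ (A : Matrix α (Fin r) ℂ) (B : Matrix β (Fin r) ℂ),
      (M * tensorPow (ketBra (factorVec A B)) (r + 1)).trace.re = 0) (v : α × β → ℂ) :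
    (M * tensorPow (ketBra v) (r + 1)).trace.re ≤
      (antisymmetrizer (Equiv.refl (α × β)) (r + 1) * tensorPow (ketBra v) (r + 1)).trace.re := by
  rw [tensorPow_ketBra]
  exact re_trace_mul_ketBra_le_of_mulVec_eq hM hM1 (antisymmetrizer_isHermitian _ _)
    (antisymmetrizer_mul_self _ _) (mulVec_antisymmetrizer_mulVec hM h v)

end SchmidtRank

/-! ### From acceptance probabilities to copy complexity. -/

section CopyComplexity

variable {ι : Type} [Fintype ι] [DecidableEq ι] {S P : Set (Matrix ι ι ℂ)} {r : ℕ}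

theorem copyComplexity_le {k ℓ : ℕ} {ε x : ℝ} {T : AdaptiveTest ι ℓ k}
    (hT : T.SucceedsOneSided S P ε) (hx : (k * ℓ : ℝ) ≤ x) :
    (copyComplexity S P ℓ ε : ENNReal) ≤ ENNReal.ofReal x := by
  have h : copyComplexity S P ℓ ε ≤ ((k * ℓ : ℕ) : ℕ∞) := sInf_le ⟨k, T, hT, rfl⟩
  calc (copyComplexity S P ℓ ε : ENNReal) ≤ (((k * ℓ : ℕ) : ℕ∞) : ENNReal) :=
        ENat.toENNReal_mono h
    _ = ENNReal.ofReal ((k * ℓ : ℕ) : ℝ) := by rw [ENat.toENNReal_coe, ENNReal.ofReal_natCast]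
    _ ≤ _ := ENNReal.ofReal_le_ofReal (by exact_mod_cast hx)

theorem le_copyComplexity {ℓ : ℕ} {ε x : ℝ}
    (h : ∀ (k : ℕ) (T : AdaptiveTest ι ℓ k), T.SucceedsOneSided S P ε → x ≤ (k * ℓ : ℝ)) :
    ENNReal.ofReal x ≤ (copyComplexity S P ℓ ε : ENNReal) := by
  rw [copyComplexity]
  rcases Set.eq_empty_or_nonempty {N : ℕ∞ | ∃ (k : ℕ) (T : AdaptiveTest ι ℓ k),
    T.SucceedsOneSided S P ε ∧ N = ((k * ℓ : ℕ) : ℕ∞)} with hemp | hne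
  · rw [hemp]
    simp
  · obtain ⟨k, T, hT, hN⟩ := csInf_mem hne
    rw [hN, ENat.toENNReal_coe, ← ENNReal.ofReal_natCast]
    exact ENNReal.ofReal_le_ofReal (by exact_mod_cast h k T hT)

theorem one_sub_pow_le_two_thirds {p q : ℝ} (hq : 0 < q) (hqp : q ≤ p) (hp : p ≤ 1) {k : ℕ}
    (hk : 1 / q ≤ k) : (1 - p) ^ k ≤ 1 - 1 / 3 := by
  have h1 : 1 - p ≤ Real.exp (-q) := by linarith [Real.add_one_le_exp (-q)]
  have h2 : 1 ≤ k * q := (div_le_iff₀ hq).1 hk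
  calc (1 - p) ^ k ≤ Real.exp (-q) ^ k := by
        gcongr
    _ = Real.exp (-(k * q)) := by rw [← Real.exp_nat_mul]; ring_nf
    _ ≤ Real.exp (-1) := Real.exp_le_exp.2 (by linarith)
    _ ≤ _ := by
        rw [Real.exp_neg]
        refine (inv_anti₀ (by norm_num) Real.exp_one_gt_d9.le).trans ?_
        norm_num

theorem copyComplexity_le_of_projection {Q : Matrix (Fin (r + 1) → ι) (Fin (r + 1) → ι) ℂ}
    (hQ : Q.IsHermitian) (hQ2 : Q * Q = Q) (hS : S ⊆ states ι) (hP : P ⊆ states ι) {ε δ : ℝ}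
    (hδ : 0 < δ) (hδ1 : δ ≤ 1) (h0 : ∀ ρ ∈ P, (Q * tensorPow ρ (r + 1)).trace.re = 0)
    (h1 : ∀ ρ ∈ S, IsFar P ε ρ →
      δ ^ r / (2 * Nat.factorial r) ≤ (Q * tensorPow ρ (r + 1)).trace.re) :
    (copyComplexity S P (r + 1) ε : ENNReal) ≤
      ENNReal.ofReal (3 * ((Nat.factorial (r + 1) : ℝ) / δ ^ r)) := by
  have hfac : (1 : ℝ) ≤ Nat.factorial r := by exact_mod_cast Nat.factorial_pos r
  have hpow : 0 < δ ^ r := by positivity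
  have hpow1 : δ ^ r ≤ 1 := pow_le_one₀ hδ.le hδ1
  refine copyComplexity_le (T := AdaptiveTest.rejectOn hQ hQ2
    ⌈1 / (δ ^ r / (2 * Nat.factorial r))⌉₊) ⟨fun ρ hρ => ?_, fun ρ hρ hfar => ?_⟩ ?_
  · rw [AdaptiveTest.acceptProb_rejectOn hQ hQ2 (hP hρ), h0 ρ hρ]
    simp
  · rw [AdaptiveTest.acceptProb_rejectOn hQ hQ2 (hS hρ)]
    refine one_sub_pow_le_two_thirds (by positivity) (h1 ρ hρ hfar) ?_ (Nat.le_ceil _)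
    have := trace_mul_nonneg (posSemidef_one_sub_of_projection hQ hQ2)
      (posSemidef_tensorPow (ℓ := r + 1) (hS hρ).1)
    rw [Matrix.sub_mul, trace_sub, Matrix.one_mul, trace_tensorPow, (hS hρ).2] at this
    simpa using this
  · have h3 := (Nat.ceil_lt_add_one (a := 1 / (δ ^ r / (2 * Nat.factorial r)))
      (by positivity)).le
    -- Rounding up costs at most one round, and `1 ≤ r! / δ^r`; this turns the constant `2` into
    -- `3`.
    have h4 : 1 ≤ (Nat.factorial r : ℝ) / δ ^ r := by
      rw [le_div_iff₀ hpow]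
      linarith
    have h5 : 1 / (δ ^ r / (2 * (Nat.factorial r : ℝ))) = 2 * (Nat.factorial r / δ ^ r) := by
      field_simp
    rw [h5] at h3 ⊢
    rw [Nat.factorial_succ]
    push_cast
    calc (⌈2 * ((Nat.factorial r : ℝ) / δ ^ r)⌉₊ : ℝ) * ((r : ℝ) + 1)
        ≤ (3 * ((Nat.factorial r : ℝ) / δ ^ r)) * ((r : ℝ) + 1) := by
          gcongr
          linarith
      _ = _ := by ring

theorem le_copyComplexity_of_acceptProb {ε δ : ℝ} (hδ : 0 < δ) (hδ1 : 3 * δ ≤ 1) (hr : 1 ≤ r)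
    {ρ₀ : Matrix ι ι ℂ} (hρ₀ : ρ₀ ∈ S) (hfar : IsFar P ε ρ₀)
    (h : ∀ (k : ℕ) (T : AdaptiveTest ι (r + 1) k), T.SucceedsOneSided S P ε →
      (1 - 3 * δ ^ r / Nat.factorial r) ^ k ≤ T.acceptProb ρ₀) :
    ENNReal.ofReal (1 / 9 * ((Nat.factorial (r + 1) : ℝ) / δ ^ r)) ≤
      (copyComplexity S P (r + 1) ε : ENNReal) := by
  refine le_copyComplexity fun k T hT => ?_
  have hfac : (1 : ℝ) ≤ Nat.factorial r := by exact_mod_cast Nat.factorial_pos r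
  have hpow : 0 < δ ^ r := by positivity
  have hpow1 : δ ^ r ≤ δ := pow_le_of_le_one hδ.le (by linarith) (by omega)
  set p : ℝ := 3 * δ ^ r / Nat.factorial r with hp
  have hp1 : p ≤ 1 := by
    rw [hp, div_le_one (by linarith)]
    linarith
  -- Bernoulli: `1 - k p ≤ (1 - p)^k ≤ 2/3` forces `k p ≥ 1/3`; with `p = 3 δ^r / r!` this is the
  -- origin of `1/9`.
  have h1 := one_add_mul_le_pow (a := -p) (by linarith) k
  have h2 := (h k T hT).trans (hT.2 ρ₀ hρ₀ hfar)
  rw [← sub_eq_add_neg] at h1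
  have h3 : 1 / 3 ≤ k * p := by linarith
  have h4 : (Nat.factorial r : ℝ) / δ ^ r ≤ 9 * k := by
    rw [hp, mul_div_assoc', le_div_iff₀ (by linarith)] at h3
    rw [div_le_iff₀ hpow]
    linarith
  rw [Nat.factorial_succ]
  push_cast
  calc 1 / 9 * (((r : ℝ) + 1) * Nat.factorial r / δ ^ r)
      = 1 / 9 * (r + 1) * (Nat.factorial r / δ ^ r) := by ring
    _ ≤ 1 / 9 * (r + 1) * (9 * k) := by gcongr
    _ = _ := by ring

end CopyComplexity

/-! ### The spectrum of the hard instances. -/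

section HardSpectrum

/-- A probability distribution on `ℕ` with one large weight and `r ^ 2 + r - 1` equal small weights,
whose mass outside of the `r` largest weights is `δ`. -/
noncomputable def hardSpectrum (r : ℕ) (δ : ℝ) (n : ℕ) : ℝ :=
  if n = 0 then 1 - (r ^ 2 + r - 1) * (δ / r ^ 2) else if n < r ^ 2 + r then δ / r ^ 2 else 0

variable {r : ℕ} {δ : ℝ}

theorem hardSpectrum_zero : hardSpectrum r δ 0 = 1 - (r ^ 2 + r - 1) * (δ / r ^ 2) :=
  if_pos rfl

theorem hardSpectrum_of_le {n : ℕ} (hr : 1 ≤ r) (h : r ^ 2 + r ≤ n) : hardSpectrum r δ n = 0 := by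
  rw [hardSpectrum, if_neg (by nlinarith), if_neg (by omega)]

theorem hardSpectrum_le (_hδ : 0 ≤ δ) {n : ℕ} (hn : n ≠ 0) : hardSpectrum r δ n ≤ δ / r ^ 2 := by
  rw [hardSpectrum, if_neg hn]
  split_ifs
  exacts [le_rfl, by positivity]

theorem le_hardSpectrum_zero (hr : 1 ≤ r) (hδ : 0 ≤ δ) (hδ1 : 2 * δ ≤ 1) :
    δ / r ^ 2 ≤ hardSpectrum r δ 0 := by
  have hr' : (1 : ℝ) ≤ r := by exact_mod_cast hr
  have h : (r ^ 2 + r) * (δ / r ^ 2) ≤ 1 := by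
    rw [mul_div_assoc', div_le_one (by positivity)]
    have h1 : (r : ℝ) ≤ r ^ 2 := by nlinarith
    calc ((r : ℝ) ^ 2 + r) * δ ≤ (r ^ 2 + r ^ 2) * δ := by gcongr
      _ = r ^ 2 * (2 * δ) := by ring
      _ ≤ r ^ 2 * 1 := by gcongr
      _ = r ^ 2 := mul_one _
  rw [hardSpectrum_zero]
  linarith

theorem hardSpectrum_zero_add (hr : 1 ≤ r) :
    hardSpectrum r δ 0 + (r - 1) * (δ / r ^ 2) = 1 - δ := by
  have hr' : (1 : ℝ) ≤ r := by exact_mod_cast hr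
  rw [hardSpectrum_zero]
  field_simp
  ring

theorem hardSpectrum_nonneg (hr : 1 ≤ r) (hδ : 0 ≤ δ) (hδ1 : 2 * δ ≤ 1) (n : ℕ) :
    0 ≤ hardSpectrum r δ n := by
  by_cases hn : n = 0
  · subst hn
    exact le_trans (by positivity) (le_hardSpectrum_zero hr hδ hδ1)
  · rw [hardSpectrum, if_neg hn]
    split_ifs
    exacts [by positivity, le_rfl]

theorem sum_hardSpectrum (hr : 1 ≤ r) {d : ℕ} (hd : r ^ 2 + r ≤ d) :
    ∑ i : Fin d, hardSpectrum r δ i = 1 := by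
  rw [Fin.sum_univ_eq_sum_range (hardSpectrum r δ) d, ← Finset.sum_subset
    (Finset.range_subset_range.2 hd) fun n _ hn => hardSpectrum_of_le hr (by simpa using hn)]
  obtain ⟨m, hm⟩ : ∃ m, r ^ 2 + r = m + 1 := ⟨r ^ 2 + r - 1, by omega⟩
  have hm' : (r : ℝ) ^ 2 + r = m + 1 := by exact_mod_cast hm
  rw [hm, Finset.sum_range_succ', hardSpectrum_zero, hm',
    Finset.sum_congr rfl (g := fun _ => δ / (r : ℝ) ^ 2)]
  · simp
  · intro n hn
    have := Finset.mem_range.1 hn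
    rw [hardSpectrum, if_neg (by omega), if_pos (by omega)]

/-- The total small mass is at most `δ (1 + 1/r)`, and `(1 + 1/r)^r ≤ e ≤ 3`. Small weights of order
`δ / r²` are what keeps this factor bounded in `r`. -/
theorem injSum_hardSpectrum_le (hr : 1 ≤ r) (hδ : 0 ≤ δ) (hδ1 : 2 * δ ≤ 1) {d : ℕ}
    (hd : r ^ 2 + r ≤ d) :
    (Nat.factorial (r + 1) : ℝ)⁻¹ * injSum (fun i : Fin d => hardSpectrum r δ i) (r + 1) ∅ ≤
      3 * δ ^ r / Nat.factorial r := by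
  have hr' : (1 : ℝ) ≤ r := by exact_mod_cast hr
  have hd0 : 0 < d := by nlinarith
  have h := injSum_le (lam := fun i : Fin d => hardSpectrum r δ i)
    (fun i => hardSpectrum_nonneg hr hδ hδ1 i) ⟨0, hd0⟩ r
  have hsum := sum_hardSpectrum (δ := δ) hr hd
  have hc : ∑ i ∈ ({⟨0, hd0⟩} : Finset (Fin d))ᶜ, hardSpectrum r δ i ≤ δ * (1 + 1 / r) := by
    have h1 := Finset.sum_compl_add_sum {(⟨0, hd0⟩ : Fin d)} fun i => hardSpectrum r δ i
    rw [hsum, Finset.sum_singleton] at h1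
    simp only [hardSpectrum_zero] at h1
    have h2 : (r ^ 2 + r) * (δ / r ^ 2) = δ * (1 + 1 / (r : ℝ)) := by field_simp
    have h3 : 0 ≤ δ / (r : ℝ) ^ 2 := by positivity
    linarith
  have hexp : (1 + 1 / (r : ℝ)) ^ r ≤ 3 := by
    calc (1 + 1 / (r : ℝ)) ^ r ≤ Real.exp (1 / r) ^ r := by
          gcongr
          linarith [Real.add_one_le_exp (1 / (r : ℝ))]
      _ = Real.exp 1 := by
          rw [← Real.exp_nat_mul, mul_one_div_cancel (by positivity)]
      _ ≤ 3 := by linarith [Real.exp_one_lt_d9]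
  have hpow : (∑ i ∈ ({⟨0, hd0⟩} : Finset (Fin d))ᶜ, hardSpectrum r δ i) ^ r ≤ 3 * δ ^ r := by
    calc (∑ i ∈ ({⟨0, hd0⟩} : Finset (Fin d))ᶜ, hardSpectrum r δ i) ^ r
        ≤ (δ * (1 + 1 / (r : ℝ))) ^ r :=
          pow_le_pow_left₀ (Finset.sum_nonneg fun (i : Fin d) _ =>
            hardSpectrum_nonneg hr hδ hδ1 i) hc r
      _ = δ ^ r * (1 + 1 / (r : ℝ)) ^ r := mul_pow _ _ _
      _ ≤ δ ^ r * 3 := by gcongr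
      _ = _ := mul_comm _ _
  rw [hsum, mul_one] at h
  have hfac : (0 : ℝ) < Nat.factorial r := by exact_mod_cast Nat.factorial_pos r
  rw [Nat.factorial_succ]
  push_cast
  calc _ ≤ (((r : ℝ) + 1) * Nat.factorial r)⁻¹ * ((r + 1) * (3 * δ ^ r)) := by
        gcongr
        exact h.trans (by gcongr)
    _ = _ := by field_simp

end HardSpectrum

/-! ### Bipartite vectors as matrices. -/

section CoefficientMatrix

variable {α β : Type}

/-- The coefficient matrix of a bipartite vector. -/
def coeffMatrix (ψ : α × β → ℂ) : Matrix α β ℂ := of fun i j => ψ (i, j)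

variable [Fintype β]

theorem partialTrace_ketBra (ψ : α × β → ℂ) :
    partialTrace (Equiv.refl (α × β)) (ketBra ψ) = coeffMatrix ψ * (coeffMatrix ψ)ᴴ := by
  ext i j
  simp [partialTrace, ketBra, vecMulVec_apply, Matrix.mul_apply, coeffMatrix]

variable [Fintype α]

theorem star_dotProduct_eq_trace (ψ φ : α × β → ℂ) :
    star ψ ⬝ᵥ φ = ((coeffMatrix ψ)ᴴ * coeffMatrix φ).trace := by
  simp only [dotProduct, Fintype.sum_prod_type, Matrix.trace, diag_apply, Matrix.mul_apply,
    conjTranspose_apply, coeffMatrix, of_apply, Pi.star_apply]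
  exact Finset.sum_comm

theorem ketBra_mem_states {ι : Type} [Fintype ι] {ψ : ι → ℂ} (h : star ψ ⬝ᵥ ψ = 1) :
    ketBra ψ ∈ states ι :=
  ⟨posSemidef_vecMulVec_self_star ψ, by rw [trace_ketBra, h]⟩

theorem pureStates_subset_states {ι : Type} [Fintype ι] : pureStates ι ⊆ states ι := by
  rintro _ ⟨ψ, h, rfl⟩
  exact ketBra_mem_states h

end CoefficientMatrix

/-! ### Far states have large spectral tails. -/

section Truncation

theorem sub_sum_eq_sum_compl {ι : Type} [Fintype ι] [DecidableEq ι] {f : ι → ℝ}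
    (h : ∑ i, f i = 1) (S : Finset ι) : ∑ i ∈ Sᶜ, f i = 1 - ∑ i ∈ S, f i := by
  rw [← h, ← Finset.sum_compl_add_sum S]
  ring

theorem le_sum_compl_eigenvalues_of_isFar {ι : Type} [Fintype ι] [DecidableEq ι] {r : ℕ} {ε : ℝ}
    (hε : ε ≤ 1) {ρ : Matrix ι ι ℂ} (hρ : ρ ∈ states ι) (hfar : IsFar (rankAtMost ι r) ε ρ)
    (S : Finset ι) (hS : S.card ≤ r) : ε ≤ ∑ i ∈ Sᶜ, hρ.1.isHermitian.eigenvalues i := by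
  obtain ⟨U, hU, -, hAU⟩ := exists_unitary_diagonalization hρ.1.isHermitian
  have hnn := hρ.1.eigenvalues_nonneg
  set μ := hρ.1.isHermitian.eigenvalues
  have hsum : ∑ i, μ i = 1 := by
    have := trace_conj_diagonal hU (fun i => (μ i : ℂ))
    rw [← hAU, hρ.2] at this
    exact_mod_cast this.symm
  rw [sub_sum_eq_sum_compl hsum]
  set s := ∑ i ∈ S, μ i with hs
  have hs0 : 0 ≤ s := Finset.sum_nonneg fun i _ => hnn i
  have hs1 : s ≤ 1 := hsum ▸ Finset.sum_le_sum_of_subset_of_nonneg (Finset.subset_univ S)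
    fun i _ _ => hnn i
  rcases hs0.eq_or_lt with h0 | hpos
  · linarith
  -- The competitor is `ρ` restricted to the eigenvectors in `S` and renormalized; its distance to
  -- `ρ` is exactly `1 - s`.
  let ν : ι → ℝ := fun i => if i ∈ S then μ i / s else 0
  have hν0 : ∀ i, 0 ≤ ν i := fun i => by
    simp only [ν]
    split_ifs
    exacts [div_nonneg (hnn i) hs0, le_rfl]
  have hσ : U * diagonal (fun i => (ν i : ℂ)) * Uᴴ ∈ rankAtMost ι r := by
    refine ⟨⟨?_, ?_⟩, ?_⟩
    · refine PosSemidef.mul_mul_conjTranspose_same ?_ U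
      exact posSemidef_diagonal_iff.2 fun i => by exact_mod_cast hν0 i
    · rw [trace_conj_diagonal hU, ← Complex.ofReal_sum]
      simp only [ν, Finset.sum_ite_mem, Finset.univ_inter]
      rw [← Finset.sum_div, div_self hpos.ne', Complex.ofReal_one]
    · refine ((rank_mul_le_left _ _).trans (rank_mul_le_right _ _)).trans ?_
      rw [rank_diagonal, Fintype.card_subtype]
      refine (Finset.card_le_card fun i hi => ?_).trans hS
      by_contra h
      simp [ν, h] at hi
  refine (hfar _ hσ).trans ?_
  have hdiff : ρ - U * diagonal (fun i => (ν i : ℂ)) * Uᴴ =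
      U * diagonal (fun i => ((μ i - ν i : ℝ) : ℂ)) * Uᴴ := by
    conv_lhs => rw [hAU]
    rw [← Matrix.sub_mul, ← Matrix.mul_sub, diagonal_sub]
    simp
  rw [traceDist, hdiff, traceNorm_conj_diagonal hU]
  have habs : ∀ i, |μ i - ν i| = μ i + if i ∈ S then μ i / s - 2 * μ i else 0 := by
    intro i
    simp only [ν]
    split_ifs with h
    · have : μ i ≤ μ i / s := le_div_self (hnn i) hpos hs1
      rw [abs_of_nonpos (by linarith)]
      ring
    · rw [sub_zero, add_zero, abs_of_nonneg (hnn i)]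
  simp only [habs, Finset.sum_add_distrib, hsum, Finset.sum_ite_mem, Finset.univ_inter,
    Finset.sum_sub_distrib, ← Finset.mul_sum, ← Finset.sum_div, ← hs, div_self hpos.ne']
  linarith

theorem sq_le_sum_compl_eigenvalues_of_isFar {α β : Type} [Fintype α] [Fintype β] [DecidableEq α]
    [DecidableEq β] {r : ℕ} {ε : ℝ} (hε0 : 0 ≤ ε) (hε : ε ≤ 1) {ψ : α × β → ℂ}
    (hψ : star ψ ⬝ᵥ ψ = 1) (hfar : IsFar (schmidtRankAtMost α β r) ε (ketBra ψ))
    (hA : (coeffMatrix ψ * (coeffMatrix ψ)ᴴ).PosSemidef)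
    (S : Finset α) (hS : S.card ≤ r) : ε ^ 2 ≤ ∑ i ∈ Sᶜ, hA.isHermitian.eigenvalues i := by
  obtain ⟨U, hU, -, hAU⟩ := exists_unitary_diagonalization hA.isHermitian
  have hnn := hA.eigenvalues_nonneg
  set μ := hA.isHermitian.eigenvalues
  set X := coeffMatrix ψ with hX
  have hsum : ∑ i, μ i = 1 := by
    have := trace_conj_diagonal hU (fun i => (μ i : ℂ))
    rw [← hAU, trace_mul_comm, ← star_dotProduct_eq_trace, hψ] at this
    exact_mod_cast this.symm
  rw [sub_sum_eq_sum_compl hsum]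
  set s := ∑ i ∈ S, μ i with hs
  have hs0 : 0 ≤ s := Finset.sum_nonneg fun i _ => hnn i
  rcases hs0.eq_or_lt with h0 | hpos
  · nlinarith
  let Q : Matrix α α ℂ := U * diagonal (fun i => (((if i ∈ S then 1 else 0 : ℝ)) : ℂ)) * Uᴴ
  have hQ : Q.IsHermitian := isHermitian_conj_diagonal U _
  have hQ2 : Q * Q = Q := by
    simp only [Q]
    rw [conj_diagonal_mul hU]
    congr 3
    ext i
    split_ifs <;> simp
  have hQrank : Q.rank ≤ r := by
    refine ((rank_mul_le_left _ _).trans (rank_mul_le_right _ _)).trans ?_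
    rw [rank_diagonal, Fintype.card_subtype]
    refine (Finset.card_le_card fun i hi => ?_).trans hS
    by_contra h
    simp [h] at hi
  have hQtr : (Xᴴ * (Q * X)).trace = (s : ℂ) := by
    rw [trace_mul_comm, Matrix.mul_assoc, hAU, conj_diagonal_mul hU, trace_conj_diagonal hU, hs]
    rw [Complex.ofReal_sum, ← Finset.sum_subset (Finset.subset_univ S)]
    · exact Finset.sum_congr rfl fun i hi => by simp [hi]
    · intro i _ hi
      simp [hi]
  -- The normalized projection of `ψ` has overlap `√s` with `ψ`, hence squared distance `1 - s`;
  -- this is why `ε²` replaces `ε`.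
  let φ : α × β → ℂ := fun p => ((√s)⁻¹ : ℝ) * (Q * X) p.1 p.2
  have hφc : coeffMatrix φ = (((√s)⁻¹ : ℝ) : ℂ) • (Q * X) := by
    ext i j
    simp [coeffMatrix, φ]
  have hsq : √s * √s = s := Real.mul_self_sqrt hs0
  have hsqpos : 0 < √s := Real.sqrt_pos.2 hpos
  have hψφ : star ψ ⬝ᵥ φ = (√s : ℂ) := by
    rw [star_dotProduct_eq_trace, hφc, Matrix.mul_smul, trace_smul, hQtr, smul_eq_mul,
      ← Complex.ofReal_mul]
    congr 1
    field_simp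
    linarith
  have hφ : star φ ⬝ᵥ φ = 1 := by
    rw [star_dotProduct_eq_trace, hφc, conjTranspose_smul, Matrix.smul_mul, Matrix.mul_smul,
      trace_smul, trace_smul, conjTranspose_mul, hQ.eq, Matrix.mul_assoc, ← Matrix.mul_assoc Q Q,
      hQ2, hQtr]
    simp only [Complex.star_def, Complex.conj_ofReal, smul_eq_mul]
    rw [← Complex.ofReal_mul, ← Complex.ofReal_mul, ← Complex.ofReal_one]
    congr 1
    field_simp
    linarith
  have hmem : ketBra φ ∈ schmidtRankAtMost α β r := by
    refine ⟨φ, hφ, ?_, rfl⟩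
    change (coeffMatrix φ).rank ≤ r
    have : coeffMatrix φ = Q * ((((√s)⁻¹ : ℝ) : ℂ) • X) := by rw [hφc, Matrix.mul_smul]
    rw [this]
    exact (rank_mul_le_left _ _).trans hQrank
  have h1 := hfar _ hmem
  have h2 := traceDist_ketBra_sq hψ hφ
  rw [hψφ, Complex.norm_real, Real.norm_eq_abs, sq_abs, sq (√s), hsq] at h2
  rw [← h2]
  exact pow_le_pow_left₀ hε0 h1 2

end Truncation

/-! ### Probability of the antisymmetrizer in terms of the spectrum. -/

section SpectralTests

theorem re_trace_antisymmetrizer_mul {ι α β : Type} [Fintype ι] [DecidableEq ι] [Fintype α]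
    [Fintype β] [DecidableEq α] (e : ι ≃ α × β) {ρ : Matrix ι ι ℂ}
    (hA : (partialTrace e ρ).IsHermitian) (ℓ : ℕ) :
    (antisymmetrizer e ℓ * tensorPow ρ ℓ).trace.re =
      (Nat.factorial ℓ : ℝ)⁻¹ * injSum hA.eigenvalues ℓ ∅ := by
  rw [trace_antisymmetrizer_mul, sum_det_submatrix_eq_injSum hA, ← Complex.ofReal_natCast,
    ← Complex.ofReal_inv, ← Complex.ofReal_mul, Complex.ofReal_re]

theorem re_trace_antisymmetrizer_mul_eq_zero {ι α β : Type} [Fintype ι] [DecidableEq ι]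
    [Fintype α] [Fintype β] [DecidableEq α] (e : ι ≃ α × β) {ρ : Matrix ι ι ℂ}
    (hA : (partialTrace e ρ).IsHermitian) {ℓ : ℕ} (h : (partialTrace e ρ).rank < ℓ) :
    (antisymmetrizer e ℓ * tensorPow ρ ℓ).trace.re = 0 := by
  rw [trace_antisymmetrizer_mul, sum_det_submatrix_eq_zero hA h, mul_zero, Complex.zero_re]

theorem re_trace_antisymmetrizer_mul_diagonal_le {ι β : Type} [Fintype ι] [DecidableEq ι]
    [Fintype β] {d r : ℕ} (hr : 1 ≤ r) (hd : r ^ 2 + r ≤ d) {δ : ℝ} (hδ : 0 ≤ δ)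
    (hδ1 : 2 * δ ≤ 1) (e : ι ≃ Fin d × β) {ρ : Matrix ι ι ℂ}
    (h : partialTrace e ρ = diagonal fun i : Fin d => (hardSpectrum r δ i : ℂ)) :
    (antisymmetrizer e (r + 1) * tensorPow ρ (r + 1)).trace.re ≤
      3 * δ ^ r / Nat.factorial r := by
  have h1 := sum_det_submatrix_conj_diagonal (U := (1 : Matrix (Fin d) (Fin d) ℂ)) (by simp)
    (fun i : Fin d => (hardSpectrum r δ i : ℂ)) (r + 1)
  rw [conjTranspose_one, Matrix.one_mul, Matrix.mul_one] at h1
  have h2 : injSum (fun i : Fin d => (hardSpectrum r δ i : ℂ)) (r + 1) ∅ =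
      (injSum (fun i : Fin d => hardSpectrum r δ i) (r + 1) ∅ : ℝ) := by
    rw [injSum, injSum, Complex.ofReal_sum]
    refine Finset.sum_congr rfl fun k _ => ?_
    split_ifs <;> simp
  rw [trace_antisymmetrizer_mul, h, h1, h2, ← Complex.ofReal_natCast, ← Complex.ofReal_inv,
    ← Complex.ofReal_mul, Complex.ofReal_re]
  exact injSum_hardSpectrum_le hr hδ hδ1 hd

theorem pow_div_le_re_trace_antisymmetrizer_mul {ι α β : Type} [Fintype ι] [DecidableEq ι]
    [Fintype α] [Fintype β] [DecidableEq α] (e : ι ≃ α × β) {ρ : Matrix ι ι ℂ}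
    (hA : (partialTrace e ρ).PosSemidef) (htr : (partialTrace e ρ).trace = 1) {r : ℕ} (hr : 1 ≤ r)
    {δ : ℝ} (hδ : 0 ≤ δ) (hδr : δ * (r + 2) ≤ 1)
    (h : ∀ S : Finset α, S.card ≤ r → δ ≤ ∑ i ∈ Sᶜ, hA.isHermitian.eigenvalues i) :
    δ ^ r / (2 * Nat.factorial r) ≤
      (antisymmetrizer e (r + 1) * tensorPow ρ (r + 1)).trace.re := by
  have hsum : ∑ i, hA.isHermitian.eigenvalues i = 1 := by
    have := hA.isHermitian.trace_eq_sum_eigenvalues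
    rw [htr] at this
    simpa using (congrArg Complex.re this).symm
  have := le_injSum_of_tails hA.eigenvalues_nonneg hsum hδ hr hδr h
  rw [re_trace_antisymmetrizer_mul e hA.isHermitian, Nat.factorial_succ]
  have hfac : (0 : ℝ) < Nat.factorial r := by exact_mod_cast Nat.factorial_pos r
  push_cast
  calc δ ^ r / (2 * (Nat.factorial r : ℝ))
      = (((r : ℝ) + 1) * Nat.factorial r)⁻¹ * ((r + 1) / 2 * δ ^ r) := by field_simp
    _ ≤ _ := by gcongr

end SpectralTests

/-! ### Perfect completeness on parametrized families. -/

section Completeness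

variable {ι : Type} [Fintype ι] [DecidableEq ι] {S P : Set (Matrix ι ι ℂ)}

theorem rejectProb_eq_zero_of_smul {ℓ k : ℕ} {ε : ℝ} {T : AdaptiveTest ι ℓ k} (hP : P ⊆ states ι)
    (hT : T.SucceedsOneSided S P ε) {ρ : Matrix ι ι ℂ} (hρ : ∃ c : ℝ, ∃ σ ∈ P, ρ = (c : ℂ) • σ) :
    T.rejectProb ρ = 0 := by
  obtain ⟨c, σ, hσ, rfl⟩ := hρ
  have := AdaptiveTest.acceptProb_add_rejectProb (hP hσ) T
  rw [hT.1 σ hσ] at this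
  rw [AdaptiveTest.rejectProb_smul, show T.rejectProb σ = 0 by linarith, mul_zero]

theorem analyticOnNhd_lineMap (a b : ℂ) :
    AnalyticOnNhd ℝ (fun t : ℝ => (1 - (t : ℂ)) * a + (t : ℂ) * b) Set.univ := by
  have h : AnalyticOnNhd ℝ (fun t : ℝ => (t : ℂ)) Set.univ :=
    Complex.ofRealCLM.analyticOnNhd _
  exact ((analyticOnNhd_const.sub h).mul analyticOnNhd_const).add (h.mul analyticOnNhd_const)

theorem analyticOnNhd_star {f : ℝ → ℂ} (hf : AnalyticOnNhd ℝ f Set.univ) :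
    AnalyticOnNhd ℝ (fun t => star (f t)) Set.univ :=
  fun t ht => (Complex.conjCLE.toContinuousLinearMap.analyticAt _).comp (hf t ht)

end Completeness

/-! ### Bounds for testing the rank. -/

section RankTesting

variable {d r : ℕ} {ε : ℝ}

theorem partialTrace_prodPUnit {ι : Type} (ρ : Matrix ι ι ℂ) :
    partialTrace (Equiv.prodPUnit ι).symm ρ = ρ := by
  ext i j
  simp [partialTrace]

theorem rankCopyComplexity_le (hr : 1 ≤ r) (hε : 0 < ε) (hεr : ε * (r + 2) ≤ 1) :
    (rankCopyComplexity d r ε : ENNReal) ≤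
      ENNReal.ofReal (3 * ((Nat.factorial (r + 1) : ℝ) / ε ^ r)) := by
  have hr' : (1 : ℝ) ≤ r := by exact_mod_cast hr
  have hε1 : ε ≤ 1 := by nlinarith
  have hpt := partialTrace_prodPUnit (ι := Fin d)
  refine copyComplexity_le_of_projection (antisymmetrizer_isHermitian (Equiv.prodPUnit _).symm _)
    (antisymmetrizer_mul_self _ _) subset_rfl (fun ρ hρ => hρ.1) hε hε1
    (fun ρ hρ => ?_) fun ρ hρ hfar => ?_
  · exact re_trace_antisymmetrizer_mul_eq_zero _ (by rw [hpt]; exact hρ.1.1.isHermitian)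
      (by rw [hpt]; exact Nat.lt_succ_of_le hρ.2)
  · have htail := le_sum_compl_eigenvalues_of_isFar hε1 hρ hfar
    have hA : (partialTrace (Equiv.prodPUnit (Fin d)).symm ρ).PosSemidef := by
      rw [hpt]; exact hρ.1
    refine pow_div_le_re_trace_antisymmetrizer_mul _ hA (by rw [hpt]; exact hρ.2) hr hε.le hεr ?_
    convert htail using 5
    rw [hpt]

theorem exists_smul_mem_rankAtMost {ι : Type} [Fintype ι] [DecidableEq ι] [Nonempty ι]
    (hr : 1 ≤ r) (A : Matrix ι (Fin r) ℂ) :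
    ∃ c : ℝ, ∃ σ ∈ rankAtMost ι r, A * Aᴴ = (c : ℂ) • σ := by
  by_cases h0 : (A * Aᴴ).trace = 0
  -- The zero matrix is `0` times an arbitrary pure state, whose rank is at most `r` because `1 ≤
  -- r`.
  · refine ⟨0, ketBra (Pi.single (Classical.arbitrary ι) 1), ⟨ketBra_mem_states (by simp), ?_⟩, ?_⟩
    · exact (rank_vecMulVec_le _ _).trans hr
    · rw [trace_mul_conjTranspose_self_eq_zero_iff] at h0
      simp [h0]
  · have hpsd := posSemidef_self_mul_conjTranspose A
    have hreal : (A * Aᴴ).trace = ((A * Aᴴ).trace.re : ℂ) :=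
      Complex.ext rfl (Complex.le_def.1 hpsd.trace_nonneg).2.symm
    set c := (A * Aᴴ).trace.re with hc
    have hc0 : (c : ℂ) ≠ 0 := hreal ▸ h0
    refine ⟨c, (c⁻¹ : ℂ) • (A * Aᴴ), ⟨⟨?_, ?_⟩, ?_⟩, ?_⟩
    · refine hpsd.smul ?_
      rw [← Complex.ofReal_inv]
      exact_mod_cast inv_nonneg.2 (Complex.le_def.1 hpsd.trace_nonneg).1
    · rw [trace_smul, hreal, smul_eq_mul, inv_mul_cancel₀ hc0]
    · rw [← Matrix.smul_mul]
      exact (rank_mul_le_right _ _).trans ((rank_conjTranspose A).trans_le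
        ((rank_le_card_width A).trans (by simp)))
    · rw [smul_smul, mul_inv_cancel₀ hc0, one_smul]

theorem le_rankCopyComplexity (hr : 1 ≤ r) (hε : 0 < ε) (hεr : ε * (r + 2) ≤ 1)
    (hd : r ^ 2 + r ≤ d) :
    ENNReal.ofReal (1 / 9 * ((Nat.factorial (r + 1) : ℝ) / ε ^ r)) ≤
      (rankCopyComplexity d r ε : ENNReal) := by
  have hr' : (1 : ℝ) ≤ r := by exact_mod_cast hr
  have hε3 : 3 * ε ≤ 1 := by nlinarith
  have hd0 : 0 < d := by nlinarith
  have : Nonempty (Fin d) := ⟨⟨0, hd0⟩⟩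
  set ρ₀ : Matrix (Fin d) (Fin d) ℂ := diagonal fun i => (hardSpectrum r ε i : ℂ) with hρ₀def
  have hρ₀ : ρ₀ ∈ states (Fin d) := by
    refine ⟨posSemidef_diagonal_iff.2 fun i => ?_, ?_⟩
    · exact_mod_cast hardSpectrum_nonneg hr hε.le (by linarith) i
    · rw [hρ₀def, trace_diagonal, ← Complex.ofReal_sum, sum_hardSpectrum hr hd, Complex.ofReal_one]
  refine le_copyComplexity_of_acceptProb hε hε3 hr hρ₀ (fun σ hσ => ?_) fun k T hT => ?_
  -- The effect `1 - Q`, with `Q` the support projection of `σ`, never occurs on `σ`. On `ρ₀` it has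
  -- probability at least `ε`, since rank `r` captures mass at most `1 - ε`.
  · obtain ⟨Q, hQ, hQ2, hQσ, hQtr⟩ := exists_support_projection hσ.1.1.isHermitian
    have h1 := re_trace_mul_le_traceNorm (A := ρ₀ - σ) (hρ₀.1.isHermitian.sub hσ.1.1.isHermitian)
      (by rw [trace_sub, hρ₀.2, hσ.1.2, sub_self])
      (posSemidef_one_sub_of_projection hQ hQ2) (by
        rw [sub_sub_cancel]; exact posSemidef_of_projection hQ hQ2)
    have h2 := trace_projection_mul_diagonal_le hQ hQ2 (r := r) (by
      rw [hQtr, Complex.natCast_re]; exact_mod_cast hσ.2)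
      (lam := fun i : Fin d => hardSpectrum r ε i) (i₀ := ⟨0, hd0⟩) (a := ε / r ^ 2)
      (by positivity) (le_hardSpectrum_zero hr hε.le (by linarith)) le_rfl
      (fun i hi => hardSpectrum_le hε.le fun h => hi (Fin.ext h))
    rw [hardSpectrum_zero_add hr] at h2
    rw [traceDist]
    refine le_trans ?_ h1
    rw [Matrix.sub_mul, Matrix.one_mul, Matrix.mul_sub, hQσ, trace_sub, trace_sub, trace_sub,
      hρ₀.2, hσ.1.2]
    simp only [Complex.sub_re, Complex.one_re]
    linarith
  · have hfac : (1 : ℝ) ≤ Nat.factorial r := by exact_mod_cast Nat.factorial_pos r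
    have hpow : ε ^ r ≤ ε := pow_le_of_le_one hε.le (by linarith) (by omega)
    refine AdaptiveTest.pow_le_acceptProb (V := Matrix (Fin d) (Fin r) ℂ)
      (ρ := fun A => A * Aᴴ) (fun A => posSemidef_self_mul_conjTranspose A) ?_ hρ₀
      (by rw [div_le_one (by linarith)]; linarith) ?_ T fun A =>
        rejectProb_eq_zero_of_smul (fun ρ hρ => hρ.1) hT (exists_smul_mem_rankAtMost hr A)
    · intro A B
      refine ⟨fun t => of fun i j => (1 - (t : ℂ)) * A i j + (t : ℂ) * B i j, by ext; simp,
        by ext; simp, fun i j => ?_⟩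
      simp only [Matrix.mul_apply, conjTranspose_apply, of_apply]
      exact Finset.analyticOnNhd_fun_sum _ fun s _ =>
        (analyticOnNhd_lineMap _ _).mul (analyticOnNhd_star (analyticOnNhd_lineMap _ _))
    · intro M hM hM1 hvan
      exact (trace_mul_le_of_vanishing_on_rank hM hM1 hvan hρ₀.1).trans
        (re_trace_antisymmetrizer_mul_diagonal_le hr hd hε.le (by linarith) _
          (partialTrace_prodPUnit _))

end RankTesting

/-! ### Bounds for testing the Schmidt rank. -/

section SchmidtRankTesting

variable {dA dB r : ℕ} {ε : ℝ}

theorem schmidtRankCopyComplexity_le (hr : 1 ≤ r) (hε : 0 < ε) (hεr : ε * (r + 2) ≤ 1) :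
    (schmidtRankCopyComplexity dA dB r ε : ENNReal) ≤
      ENNReal.ofReal (3 * ((Nat.factorial (r + 1) : ℝ) / ε ^ (2 * r))) := by
  have hr' : (1 : ℝ) ≤ r := by exact_mod_cast hr
  have hε1 : ε ≤ 1 := by nlinarith
  rw [pow_mul]
  refine copyComplexity_le_of_projection (antisymmetrizer_isHermitian (Equiv.refl _) _)
    (antisymmetrizer_mul_self _ _) pureStates_subset_states ?_ (by positivity)
    (pow_le_one₀ hε.le hε1) ?_ ?_
  · rintro _ ⟨ψ, hψ, -, rfl⟩
    exact ketBra_mem_states hψ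
  · rintro _ ⟨ψ, hψ, hrank, rfl⟩
    have hpt := partialTrace_ketBra ψ
    refine re_trace_antisymmetrizer_mul_eq_zero _
      (by rw [hpt]; exact (posSemidef_self_mul_conjTranspose _).isHermitian) ?_
    rw [hpt, rank_self_mul_conjTranspose]
    exact Nat.lt_succ_of_le hrank
  · rintro _ ⟨ψ, hψ, rfl⟩ hfar
    have hpt := partialTrace_ketBra ψ
    have hA : (partialTrace (Equiv.refl (Fin dA × Fin dB)) (ketBra ψ)).PosSemidef := by
      rw [hpt]; exact posSemidef_self_mul_conjTranspose _
    refine pow_div_le_re_trace_antisymmetrizer_mul _ hA ?_ hr (by positivity) (by nlinarith) ?_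
    · rw [hpt, trace_mul_comm, ← star_dotProduct_eq_trace, hψ]
    · have := sq_le_sum_compl_eigenvalues_of_isFar hε.le hε1 hψ hfar
        (posSemidef_self_mul_conjTranspose _)
      convert this using 5

theorem exists_smul_mem_schmidtRankAtMost {α β : Type} [Fintype α] [Fintype β] [DecidableEq α]
    [DecidableEq β] [Nonempty α] [Nonempty β] (hr : 1 ≤ r) (A : Matrix α (Fin r) ℂ)
    (B : Matrix β (Fin r) ℂ) :
    ∃ c : ℝ, ∃ σ ∈ schmidtRankAtMost α β r, ketBra (factorVec A B) = (c : ℂ) • σ := by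
  by_cases h0 : factorVec A B = 0
  · refine ⟨0, _, ⟨Pi.single (Classical.arbitrary _) 1, by simp, ?_, rfl⟩, ?_⟩
    · have : (of fun (i : α) (j : β) => (Pi.single (Classical.arbitrary (α × β)) 1 :
          α × β → ℂ) (i, j)) = vecMulVec (Pi.single (Classical.arbitrary (α × β)).1 1)
            (Pi.single (Classical.arbitrary (α × β)).2 1) := by
        ext i j
        by_cases h1 : i = (Classical.arbitrary (α × β)).1 <;>
          by_cases h2 : j = (Classical.arbitrary (α × β)).2 <;>
            simp [vecMulVec_apply, Pi.single_apply, Prod.ext_iff, h1, h2]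
      rw [schmidtRank, this]
      exact (rank_vecMulVec_le _ _).trans hr
    · rw [h0]
      ext
      simp [ketBra, vecMulVec_apply]
  · set φ := factorVec A B with hφ
    set n : ℝ := ∑ p, ‖φ p‖ ^ 2 with hn
    have hdot : star φ ⬝ᵥ φ = (n : ℂ) := star_dotProduct_ofReal_re φ
    have hn0 : 0 < n := by
      refine lt_of_le_of_ne (Finset.sum_nonneg fun p _ => by positivity) fun h => h0 ?_
      rw [← dotProduct_star_self_eq_zero, hdot, ← h, Complex.ofReal_zero]
    have hsq : √n * √n = n := Real.mul_self_sqrt hn0.le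
    have hsq0 : (√n : ℂ) ≠ 0 := by exact_mod_cast (Real.sqrt_pos.2 hn0).ne'
    have hsqC : (√n : ℂ) * √n = n := by exact_mod_cast hsq
    refine ⟨n, _, ⟨(√n : ℂ)⁻¹ • φ, ?_, ?_, rfl⟩, ?_⟩
    · rw [star_smul, smul_dotProduct, dotProduct_smul, hdot, ← hsqC]
      simp [hsq0]
    · have : (of fun (i : α) (j : β) => ((√n : ℂ)⁻¹ • φ) (i, j)) =
          A * ((√n : ℂ)⁻¹ • Bᵀ) := by
        ext i j
        simp only [hφ, factorVec, Matrix.mul_apply, of_apply, Pi.smul_apply, Matrix.smul_apply,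
          transpose_apply, smul_eq_mul, Finset.mul_sum]
        exact Finset.sum_congr rfl fun s _ => by ring
      rw [schmidtRank, this]
      exact (rank_mul_le_left _ _).trans ((rank_le_card_width A).trans (by simp))
    · ext p q
      simp only [ketBra, vecMulVec_apply, Matrix.smul_apply, Pi.smul_apply, Pi.star_apply,
        smul_eq_mul, star_mul', Complex.star_def, map_inv₀, Complex.conj_ofReal, ← hsqC]
      field_simp

/-- A bipartite vector whose Schmidt coefficients are the square roots of `hardSpectrum`. -/
noncomputable def hardVec (dA dB r : ℕ) (δ : ℝ) : Fin dA × Fin dB → ℂ :=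
  fun p => if (p.1 : ℕ) = p.2 then ((√(hardSpectrum r δ p.1) : ℝ) : ℂ) else 0

theorem coeffMatrix_hardVec (hr : 1 ≤ r) {δ : ℝ} (hδ : 0 ≤ δ) (hδ1 : 2 * δ ≤ 1)
    (hB : r ^ 2 + r ≤ dB) :
    coeffMatrix (hardVec dA dB r δ) * (coeffMatrix (hardVec dA dB r δ))ᴴ =
      diagonal fun i : Fin dA => (hardSpectrum r δ i : ℂ) := by
  ext i i'
  rw [Matrix.mul_apply]
  simp only [coeffMatrix, hardVec, conjTranspose_apply, of_apply]
  by_cases hi : (i : ℕ) < dB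
  · rw [Finset.sum_eq_single (⟨i, hi⟩ : Fin dB)]
    · by_cases h : i = i'
      · subst h
        simp only [if_true, Complex.star_def, Complex.conj_ofReal, diagonal_apply_eq]
        rw [← Complex.ofReal_mul, Real.mul_self_sqrt (hardSpectrum_nonneg hr hδ hδ1 _)]
      · have : (i' : ℕ) ≠ i := fun h' => h (Fin.ext h'.symm)
        simp [this, h]
    · intro j _ hj
      have : (i : ℕ) ≠ j := fun h => hj (Fin.ext h.symm)
      simp [this]
    · simp
  -- Rows beyond `dB` are zero, in agreement with the weights, which vanish from `r ^ 2 + r ≤ dB`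
  -- on.
  · rw [Finset.sum_eq_zero]
    · by_cases h : i = i'
      · subst h
        rw [diagonal_apply_eq, hardSpectrum_of_le hr (by omega), Complex.ofReal_zero]
      · rw [diagonal_apply_ne _ h]
    · intro j _
      have : (i : ℕ) ≠ j := fun h => hi (h ▸ j.2)
      simp [this]

/-- If `Q` projects onto the range of the coefficient matrix of `φ`, then `|⟨ψ, φ⟩|² = |⟨Qψ, φ⟩|² ≤
‖Qψ‖²`, and a projection of rank at most `r` captures at most `1 - ε²` of the spectrum. -/
theorem isFar_hardVec (hr : 1 ≤ r) (hε1 : 2 * ε ^ 2 ≤ 1) (hA : r ^ 2 + r ≤ dA)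
    (hB : r ^ 2 + r ≤ dB) (hψ : star (hardVec dA dB r (ε ^ 2)) ⬝ᵥ hardVec dA dB r (ε ^ 2) = 1) :
    IsFar (schmidtRankAtMost (Fin dA) (Fin dB) r) ε (ketBra (hardVec dA dB r (ε ^ 2))) := by
  rintro _ ⟨φ, hφ, hrank, rfl⟩
  have hX := coeffMatrix_hardVec (dA := dA) hr (sq_nonneg ε) hε1 hB
  set ψ := hardVec dA dB r (ε ^ 2)
  set X := coeffMatrix ψ
  set Y := coeffMatrix φ
  have hd0 : 0 < dA := by nlinarith
  obtain ⟨Q, hQ, hQ2, hQY, hQtr⟩ :=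
    exists_support_projection (posSemidef_self_mul_conjTranspose Y).isHermitian
  have hQY' : Q * Y = Y := by
    have h : (Q * Y - Y) * (Q * Y - Y)ᴴ = 0 := by
      have : (Q * Y - Y) * Yᴴ = 0 := by rw [Matrix.sub_mul, Matrix.mul_assoc, hQY, sub_self]
      rw [conjTranspose_sub, conjTranspose_mul, hQ.eq, Matrix.mul_sub, ← Matrix.mul_assoc, this,
        Matrix.zero_mul, sub_zero]
    exact sub_eq_zero.1 (self_mul_conjTranspose_eq_zero.1 h)
  have h2 := trace_projection_mul_diagonal_le hQ hQ2 (r := r) (by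
    rw [hQtr, rank_self_mul_conjTranspose, Complex.natCast_re]
    exact_mod_cast hrank)
    (lam := fun i : Fin dA => hardSpectrum r (ε ^ 2) i) (i₀ := ⟨0, hd0⟩) (a := ε ^ 2 / r ^ 2)
    (by positivity) (le_hardSpectrum_zero hr (sq_nonneg ε) hε1) le_rfl
    (fun i hi => hardSpectrum_le (sq_nonneg ε) fun h => hi (Fin.ext h))
  rw [hardSpectrum_zero_add hr, ← hX] at h2
  have hcs := norm_dotProduct_sq_le (fun p => (Q * X) p.1 p.2) φ
  have hc : coeffMatrix (fun p => (Q * X) p.1 p.2) = Q * X := by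
    ext
    simp [coeffMatrix]
  rw [hφ, star_dotProduct_eq_trace, star_dotProduct_eq_trace, hc, conjTranspose_mul, hQ.eq,
    Matrix.mul_assoc, hQY', ← star_dotProduct_eq_trace, Matrix.mul_assoc, ← Matrix.mul_assoc Q Q,
    hQ2, trace_mul_comm, Matrix.mul_assoc, Complex.one_re, mul_one] at hcs
  have h3 := traceDist_ketBra_sq hψ hφ
  have h4 : 0 ≤ traceDist (ketBra ψ) (ketBra φ) :=
    mul_nonneg (by norm_num) (Finset.sum_nonneg fun i _ => Real.sqrt_nonneg _)
  exact le_of_sq_le_sq (by linarith) h4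

theorem le_schmidtRankCopyComplexity (hr : 1 ≤ r) (hε : 0 < ε) (hεr : ε * (r + 2) ≤ 1)
    (hA : r ^ 2 + r ≤ dA) (hB : r ^ 2 + r ≤ dB) :
    ENNReal.ofReal (1 / 9 * ((Nat.factorial (r + 1) : ℝ) / ε ^ (2 * r))) ≤
      (schmidtRankCopyComplexity dA dB r ε : ENNReal) := by
  have hr' : (1 : ℝ) ≤ r := by exact_mod_cast hr
  have hε3 : 3 * ε ^ 2 ≤ 1 := by nlinarith
  have hε2 : 2 * ε ^ 2 ≤ 1 := by nlinarith
  have : Nonempty (Fin dA) := ⟨⟨0, by nlinarith⟩⟩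
  have : Nonempty (Fin dB) := ⟨⟨0, by nlinarith⟩⟩
  have hX := coeffMatrix_hardVec (dA := dA) hr (sq_nonneg ε) hε2 hB
  have hψ : star (hardVec dA dB r (ε ^ 2)) ⬝ᵥ hardVec dA dB r (ε ^ 2) = 1 := by
    rw [star_dotProduct_eq_trace, trace_mul_comm, hX, trace_diagonal, ← Complex.ofReal_sum,
      sum_hardSpectrum hr hA, Complex.ofReal_one]
  rw [pow_mul]
  refine le_copyComplexity_of_acceptProb (by positivity) hε3 hr ⟨_, hψ, rfl⟩
    (isFar_hardVec hr hε2 hA hB hψ) fun k T hT => ?_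
  have hfac : (1 : ℝ) ≤ Nat.factorial r := by exact_mod_cast Nat.factorial_pos r
  have hpow : (ε ^ 2) ^ r ≤ ε ^ 2 := pow_le_of_le_one (by positivity) (by linarith) (by omega)
  refine AdaptiveTest.pow_le_acceptProb
    (V := Matrix (Fin dA) (Fin r) ℂ × Matrix (Fin dB) (Fin r) ℂ)
    (ρ := fun θ => ketBra (factorVec θ.1 θ.2)) (fun θ => posSemidef_vecMulVec_self_star _) ?_
    (ketBra_mem_states hψ) (by rw [div_le_one (by linarith)]; linarith) ?_ T fun θ =>
      rejectProb_eq_zero_of_smul ?_ hT (exists_smul_mem_schmidtRankAtMost hr θ.1 θ.2)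
  · intro θ₀ θ₁
    refine ⟨fun t => (of fun i j => (1 - (t : ℂ)) * θ₀.1 i j + (t : ℂ) * θ₁.1 i j,
      of fun i j => (1 - (t : ℂ)) * θ₀.2 i j + (t : ℂ) * θ₁.2 i j),
      Prod.ext (by ext; simp) (by ext; simp), Prod.ext (by ext; simp) (by ext; simp),
      fun i j => ?_⟩
    have hvec : ∀ p : Fin dA × Fin dB, AnalyticOnNhd ℝ (fun t : ℝ => factorVec
        (of fun i j => (1 - (t : ℂ)) * θ₀.1 i j + (t : ℂ) * θ₁.1 i j)
        (of fun i j => (1 - (t : ℂ)) * θ₀.2 i j + (t : ℂ) * θ₁.2 i j) p) Set.univ := fun p =>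
      Finset.analyticOnNhd_fun_sum _ fun s _ =>
        (analyticOnNhd_lineMap _ _).mul (analyticOnNhd_lineMap _ _)
    simp only [ketBra, vecMulVec_apply, Pi.star_apply]
    exact (hvec i).mul (analyticOnNhd_star (hvec j))
  · intro M hM hM1 hvan
    exact (trace_mul_le_of_vanishing_on_schmidtRank hM hM1 (fun A B => hvan (A, B)) _).trans
      (re_trace_antisymmetrizer_mul_diagonal_le hr hA (sq_nonneg ε) hε2 _
        ((partialTrace_ketBra _).trans hX))
  · rintro _ ⟨φ, hφ, -, rfl⟩
    exact ketBra_mem_states hφ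

end SchmidtRankTesting

end StateTesting

theorem theorem6p4 :
    ∃ c C : ℝ, 0 < c ∧ 0 < C ∧ ∀ r : ℕ, 1 ≤ r →
      -- upper bounds, in every dimension
      (∀ ε : ℝ, 0 < ε → ε < 1 / ((r : ℝ) + 2) →
        (∀ dA dB : ℕ,
          (StateTesting.schmidtRankCopyComplexity dA dB r ε : ENNReal) ≤
            ENNReal.ofReal (C * ((Nat.factorial (r + 1) : ℝ) / ε ^ (2 * r)))) ∧
        (∀ d : ℕ,
          (StateTesting.rankCopyComplexity d r ε : ENNReal) ≤
            ENNReal.ofReal (C * ((Nat.factorial (r + 1) : ℝ) / ε ^ r)))) ∧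
      -- matching lower bounds, in every sufficiently large dimension
      (∃ D : ℕ, ∀ ε : ℝ, 0 < ε → ε < 1 / ((r : ℝ) + 2) →
        (∀ dA dB : ℕ, D ≤ dA → D ≤ dB →
          ENNReal.ofReal (c * ((Nat.factorial (r + 1) : ℝ) / ε ^ (2 * r))) ≤
            (StateTesting.schmidtRankCopyComplexity dA dB r ε : ENNReal)) ∧
        (∀ d : ℕ, D ≤ d →
          ENNReal.ofReal (c * ((Nat.factorial (r + 1) : ℝ) / ε ^ r)) ≤
            (StateTesting.rankCopyComplexity d r ε : ENNReal))) := by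
  have hmul : ∀ {r : ℕ} {ε : ℝ}, ε < 1 / ((r : ℝ) + 2) → ε * (r + 2) ≤ 1 := by
    intro r ε h
    exact ((lt_div_iff₀ (by positivity)).1 h).le
  -- The threshold `D = r ^ 2 + r` is the number of weights of `hardSpectrum`.
  refine ⟨1 / 9, 3, by norm_num, by norm_num, fun r hr => ⟨fun ε hε hεr => ⟨fun dA dB => ?_,
    fun d => ?_⟩, r ^ 2 + r, fun ε hε hεr => ⟨fun dA dB hA hB => ?_, fun d hd => ?_⟩⟩⟩
  · exact StateTesting.schmidtRankCopyComplexity_le hr hε (hmul hεr)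
  · exact StateTesting.rankCopyComplexity_le hr hε (hmul hεr)
  · exact StateTesting.le_schmidtRankCopyComplexity hr hε (hmul hεr) hA hB
  · exact StateTesting.le_rankCopyComplexity hr hε (hmul hεr) hd
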